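/- **Model.** Let $I\ge 0$, $J\ge 0$. For $i=1,\dots,I$ let $\boldsymbol x_i=(x_{i0},\dots,x_{iJ})\in\mathbb R^{J+1}$ be a stress vector and $\tau_i>0$ an inspection time. For $\boldsymbol\theta=(a_0,\dots,a_J,b_0,\dots,b_J)\in\mathbb R^{2(J+1)}$ put $$\alpha_i=\exp\Big(\sum_{j=0}^J a_jx_{ij}\Big),\quad \beta_i=\exp\Big(\sum_{j=0}^J b_jx_{ij}\Big),\quad F_i=F_i(\boldsymbol\theta)=\frac{\tau_i^{\beta_i}}{\tau_i^{\beta_i}+\alpha_i^{\beta_i}},\quad R_i=1-F_i .$$ Let $\boldsymbol\theta_0\in\mathbb R^{2(J+1)}$ be the true parameter. The lifetimes $T_{ik}$ ($1\le i\le I$, $k\ge 1$) are independent, and $T_{ik}$ has the log-logistic density $\beta_i\alpha_i^{\beta_i}t^{\beta_i-1}/(t^{\beta_i}+\alpha_i^{\beta_i})^2$, $t>0$, with $\alpha_i,\beta_i$ taken at $\boldsymbol\theta_0$. If $K_i$ devices are tested under condition $i$, then $n_i=\#\{k\le K_i: T_{ik}\le\tau_i\}$ is observed, $K=K_1+\dots+K_I$,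 and the likelihood is $L(\boldsymbol\theta)=\prod_i F_i^{n_i}R_i^{K_i-n_i}$. An MLE is a function $\hat{\boldsymbol\theta}$ of $(n_1,\dots,n_I)$ that is a maximizer of $\log L$ over $\mathbb R^{2(J+1)}$ whenever a maximizer exists. For $w\in\mathbb R^I$ and $\gamma\in\mathbb R$ let $$\boldsymbol J_\gamma(\boldsymbol\theta)=\sum_i w_i\big(F_i^{\gamma-1}+R_i^{\gamma-1}\big)\frac{\partial F_i}{\partial\boldsymbol\theta}\frac{\partial F_i}{\partial\boldsymbol\theta^T},\qquad \boldsymbol K_\gamma(\boldsymbol\theta)=\sum_i w_iF_iR_i\big(F_i^{\gamma-1}+R_i^{\gamma-1}\big)^2\frac{\partial F_i}{\partial\boldsymbol\theta}\frac{\partial F_i}{\partial\boldsymbol\theta^T},$$ $$\boldsymbol I_F(\boldsymbol\theta)=\sum_i w_i\boldsymbol M_i(R_iF_i)^2\big(F_i^{-1}+R_i^{-1}\big),\qquad \boldsymbol M_i=\begin{pmatrix}\beta_i^2\boldsymbol x_i\boldsymbol x_i^T&-\log\frac{\tau_i}{\alpha_i}\,\beta_i^2\boldsymbol x_i\boldsymbol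 x_i^T\\-\log\frac{\tau_i}{\alpha_i}\,\beta_i^2\boldsymbol x_i\boldsymbol x_i^T&\big(\log\frac{\tau_i}{\alpha_i}\,\beta_i\big)^2\boldsymbol x_i\boldsymbol x_i^T\end{pmatrix}.$$ **Asymptotic regime.** $I$, the $\boldsymbol x_i$ and the $\tau_i$ are fixed, $K\to\infty$ along a sequence of sample sizes $(K_1,\dots,K_I)$, and $K_i/K\to p_i$ for every $i$. **Claim.** 1. $\boldsymbol J_{\gamma=0}(\boldsymbol\theta)=\boldsymbol K_{\gamma=0}(\boldsymbol\theta)=\boldsymbol I_F(\boldsymbol\theta)$ for all $\boldsymbol\theta$ and all $w$ (in particular for $w_i=K_i/K$ and for $w_i=p_i$). 2. $\boldsymbol I_F$ is the Fisher information matrix per device: for all sample sizes in the sequence, with $w_i=K_i/K$, $$\mathbb E_{\boldsymbol\theta_0}\Big[\frac{\partial\log L}{\partial\boldsymbol\theta}(\boldsymbol\theta_0)\,\frac{\partial\log L}{\partial\boldsymbol\theta^T}(\boldsymbol\theta_0)\Big]=K\,\boldsymbol I_F(\boldsymbol\theta_0).$$ 3. Suppose that $\boldsymbol I_F(\boldsymbol\theta_0)$,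 taken with $w_i=p_i$, is nonsingular. (a) Suppose in addition that for every $\varepsilon>0$ there is $\delta>0$ such that $|F_i(\boldsymbol\theta)-F_i(\boldsymbol\theta_0)|<\delta$ for all $i$ with $p_i>0$ implies $\|\boldsymbol\theta-\boldsymbol\theta_0\|<\varepsilon$. Then for every sequence of MLEs $\hat{\boldsymbol\theta}$, the probability that $\hat{\boldsymbol\theta}$ maximizes $\log L$ tends to $1$, $\hat{\boldsymbol\theta}\to\boldsymbol\theta_0$ in probability, and $$\sqrt K\,(\hat{\boldsymbol\theta}-\boldsymbol\theta_0)\xrightarrow{\ \mathcal L\ }N\big(\boldsymbol 0_{2(J+1)},\boldsymbol I_F(\boldsymbol\theta_0)^{-1}\big).$$ (b) Without the additional condition in (a), there are functions $\hat{\boldsymbol\theta}$ of $(n_1,\dots,n_I)$, one for each term of the sequence, with $\hat{\boldsymbol\theta}\to\boldsymbol\theta_0$ in probability that are local maximizers of $\log L$ with probability tending to $1$. Moreover, for every sequence of functions $\hat{\boldsymbol\theta}$ of the counts that tends to $\boldsymbol\theta_0$ in probability and solves the likelihood equations $\partial\log L/\partial\boldsymbol\theta=\boldsymbol 0$ with probability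 tending to $1$, $\sqrt K(\hat{\boldsymbol\theta}-\boldsymbol\theta_0)$ converges in distribution to $N(\boldsymbol 0_{2(J+1)},\boldsymbol I_F(\boldsymbol\theta_0)^{-1})$. -/

import Mathlib

open MeasureTheory ProbabilityTheory Filter Topology

noncomputable section

namespace OneShot

/-! ### The log-logistic distribution with scale `α` and shape `β` -/

/-- Density `β α^β t^(β-1) / (t^β + α^β)²` on `t > 0`, and `0` elsewhere. -/
def loglogisticPDF (α β t : ℝ) : ℝ :=
  if 0 < t then β * α ^ β * t ^ (β - 1) / (t ^ β + α ^ β) ^ 2 else 0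

/-- The law on `ℝ` with the density above. -/
def loglogisticMeasure (α β : ℝ) : Measure ℝ :=
  volume.withDensity (fun t => ENNReal.ofReal (loglogisticPDF α β t))

/-- Distribution function at `t > 0`. -/
def loglogisticCDF (α β t : ℝ) : ℝ := t ^ β / (t ^ β + α ^ β)

/-- Reliability (survival) function at `t > 0`. -/
def loglogisticSurv (α β t : ℝ) : ℝ := α ^ β / (t ^ β + α ^ β)

/-! ### The accelerated life test -/

/-- The fixed part of the test: the testing conditions are indexed by `ι`, condition `i` has the
stress vector `(x i 0, …, x i J)` and the inspection time `τ i > 0`. -/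
structure Design (ι : Type*) (J : ℕ) where
  x : ι → Fin (J + 1) → ℝ
  τ : ι → ℝ
  τ_pos : ∀ i, 0 < τ i

/-- Indices of the `2(J+1)` coordinates: `inl j` for `a_j` and `inr j` for `b_j`. -/
abbrev Coord (J : ℕ) : Type := Fin (J + 1) ⊕ Fin (J + 1)

/-- The parameter space of all `θ = (a_0, …, a_J, b_0, …, b_J)`, with the Euclidean norm. -/
abbrev Param (J : ℕ) : Type := EuclideanSpace ℝ (Coord J)

variable {ι : Type*} {J : ℕ}

/-- `α_i = exp (∑_j a_j x_ij)`. -/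
def scale (D : Design ι J) (θ : Param J) (i : ι) : ℝ :=
  Real.exp (∑ j, θ (Sum.inl j) * D.x i j)

/-- `β_i = exp (∑_j b_j x_ij)`. -/
def shape (D : Design ι J) (θ : Param J) (i : ι) : ℝ :=
  Real.exp (∑ j, θ (Sum.inr j) * D.x i j)

/-- Probability `π_i1 = F_θ(τ_i, x_i)` of failure before the inspection. -/
def failProb (D : Design ι J) (θ : Param J) (i : ι) : ℝ :=
  loglogisticCDF (scale D θ i) (shape D θ i) (D.τ i)

/-- Probability `π_i2 = R_θ(τ_i, x_i)` of survival at the inspection. -/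
def survProb (D : Design ι J) (θ : Param J) (i : ι) : ℝ :=
  loglogisticSurv (scale D θ i) (shape D θ i) (D.τ i)

/-- The vector of partial derivatives of `f` at `θ`. -/
def grad (f : Param J → ℝ) (θ : Param J) : Coord J → ℝ :=
  fun r => fderiv ℝ f θ (EuclideanSpace.single r 1)

/-! ### The matrices of the asymptotic distribution

`w i` stands for the proportion of devices under condition `i`: `K_i / K`, or its limit. -/

/-- `M_i`. -/
def blockM (D : Design ι J) (θ : Param J) (i : ι) : Matrix (Coord J) (Coord J) ℝ :=
  let X := Matrix.vecMulVec (D.x i) (D.x i)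
  let β := shape D θ i
  let l := Real.log (D.τ i / scale D θ i)
  Matrix.fromBlocks (β ^ 2 • X) (-(l * β ^ 2) • X) (-(l * β ^ 2) • X) ((l * β) ^ 2 • X)

variable [Fintype ι]

/-- `J_γ(θ) = ∑ w_i (F^(γ-1) + R^(γ-1)) ∂F/∂θ ∂F/∂θᵀ`. -/
def matJ (D : Design ι J) (w : ι → ℝ) (γ : ℝ) (θ : Param J) : Matrix (Coord J) (Coord J) ℝ :=
  ∑ i, (w i * (failProb D θ i ^ (γ - 1) + survProb D θ i ^ (γ - 1))) •
    Matrix.vecMulVec (grad (fun η => failProb D η i) θ) (grad (fun η => failProb D η i) θ)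

/-- `K_γ(θ) = ∑ w_i F R (F^(γ-1) + R^(γ-1))² ∂F/∂θ ∂F/∂θᵀ`. -/
def matK (D : Design ι J) (w : ι → ℝ) (γ : ℝ) (θ : Param J) : Matrix (Coord J) (Coord J) ℝ :=
  ∑ i, (w i * (failProb D θ i * survProb D θ i *
      (failProb D θ i ^ (γ - 1) + survProb D θ i ^ (γ - 1)) ^ 2)) •
    Matrix.vecMulVec (grad (fun η => failProb D η i) θ) (grad (fun η => failProb D η i) θ)

/-- `I_F(θ) = ∑ w_i M_i (R F)² (F⁻¹ + R⁻¹)`. -/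
def fisherMat (D : Design ι J) (w : ι → ℝ) (θ : Param J) : Matrix (Coord J) (Coord J) ℝ :=
  ∑ i, (w i * ((survProb D θ i * failProb D θ i) ^ 2 *
    ((failProb D θ i)⁻¹ + (survProb D θ i)⁻¹))) • blockM D θ i

/-! ### Data and likelihood

`K i` is the number of devices under condition `i`. -/

/-- Total number of devices. -/
def total (K : ι → ℕ) : ℕ := ∑ i, K i

/-- Proportions `K_i / K`. -/
def prop (K : ι → ℕ) (i : ι) : ℝ := (K i : ℝ) / (total K : ℝ)

/-- Number `n_i` of failures among the first `K i` devices under condition `i`, where `T i k` is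
the lifetime of device `k` under condition `i`. -/
def failures {Ω : Type*} (D : Design ι J) (T : ι → ℕ → Ω → ℝ) (K : ι → ℕ) (ω : Ω) : ι → ℕ :=
  fun i => ((Finset.range (K i)).filter (fun k => T i k ω ≤ D.τ i)).card

/-- `log L(θ)`, where `L(θ) = ∏ F_i^(n_i) R_i^(K_i - n_i)`, for the failure counts `c i = n_i`. -/
def logLik (D : Design ι J) (K : ι → ℕ) (c : ι → ℕ) (θ : Param J) : ℝ :=
  Real.log (∏ i, failProb D θ i ^ c i * survProb D θ i ^ (K i - c i))

/-- `θ` maximizes the log-likelihood over the whole parameter space. -/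
def IsMaximizer (D : Design ι J) (K : ι → ℕ) (c : ι → ℕ) (θ : Param J) : Prop :=
  ∀ θ', logLik D K c θ' ≤ logLik D K c θ

/-- `est` is a maximum likelihood estimator for the sample sizes `K`: a function of the failure
counts that picks a maximizer of the likelihood whenever there is one. (For some counts, such as
`c = 0`, there may be none; the value is then arbitrary.) -/
def IsMLE (D : Design ι J) (K : ι → ℕ) (est : (ι → ℕ) → Param J) : Prop :=
  ∀ c : ι → ℕ, (∀ i, c i ≤ K i) → (∃ θ, IsMaximizer D K c θ) → IsMaximizer D K c (est c)

/-- The failure probabilities under the conditions with `0 < p i` determine `θ₀` in a stable way: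
they are bounded away from those of `θ₀` outside each ball about `θ₀`. -/
def WellSeparated (D : Design ι J) (p : ι → ℝ) (θ₀ : Param J) : Prop :=
  ∀ ε > 0, ∃ δ > 0, ∀ θ : Param J,
    (∀ i, 0 < p i → |failProb D θ i - failProb D θ₀ i| < δ) → dist θ θ₀ < ε

/-- `√K (est_n - θ₀)` converges in distribution to `N(0, I_F(θ₀)⁻¹)`, where the estimators
`est n` are evaluated at the failure counts. -/
def AsympNormal {Ω : Type*} [MeasurableSpace Ω] (P : Measure Ω) [IsProbabilityMeasure P]
    (D : Design ι J) (p : ι → ℝ) (θ₀ : Param J) (T : ι → ℕ → Ω → ℝ) (K : ℕ → ι → ℕ)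
    (est : ℕ → (ι → ℕ) → Param J) : Prop :=
  TendstoInDistribution
    (fun n ω => Real.sqrt (total (K n)) • (est n (failures D T (K n) ω) - θ₀)) atTop
    (id : Param J → Param J) (fun _ => P)
    (multivariateGaussian (0 : Param J) (fisherMat D p θ₀)⁻¹)

/-- The estimators `est n`, evaluated at the failure counts, converge to `θ₀` in probability. -/
def Consistent {Ω : Type*} [MeasurableSpace Ω] (P : Measure Ω)
    (D : Design ι J) (θ₀ : Param J) (T : ι → ℕ → Ω → ℝ) (K : ℕ → ι → ℕ)
    (est : ℕ → (ι → ℕ) → Param J) : Prop :=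
  TendstoInMeasure P (fun n ω => est n (failures D T (K n) ω)) atTop (fun _ => θ₀)

end OneShot

end

/-! The log-odds of failure are `β_i log (τ_i / α_i)`, so `F_i` is a sigmoid of a smooth function of
the parameter and `∂F_i/∂θ = F_i R_i g_i`, with `g_i` the gradient of the log-odds. Moreover `M_i =
g_i g_iᵀ`. Since `F_i + R_i = 1`, the three matrices reduce to `∑ w_i F_i R_i g_i g_iᵀ`. The score
is `∑ (n_i - K_i F_i) g_i`; the counts are independent binomials with variances `K_i F_i R_i`,
whence the Fisher information identity.

Consistency rests on `binomial_logLik_sub_le`, a Hellinger-type bound on the log-likelihood ratio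
against `θ₀`: a negative drift quadratic in `F_i(θ) - F_i(θ₀)`, plus the count fluctuation times a
constant that does not depend on `θ`. By Chebyshev the fluctuations are `o(K)`, so every `θ` whose
failure probabilities are separated from those of `θ₀` loses to `θ₀`. Separation is assumed for the
global MLE. A nonsingular information matrix gives it on a small ball, because the derivative of `θ
↦ (F_i)` over the conditions with `p_i > 0` is then injective.

Asymptotic normality needs no second derivatives. Writing `F_i(θ) - F_i(θ₀)` as a slope vector,
continuous at `θ₀`, paired with `θ - θ₀` turns the likelihood equations into the exact linear system
`A √K (θ - θ₀) = G Z`. Here `Z` is the vector of normalized counts, `G` has the columns `g_i(θ)`,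
and `A` tends to `I_F(θ₀)` in probability. The central limit theorem for `Z` and Slutsky's theorem
give a Gaussian limit, whose sandwich covariance collapses to `I_F(θ₀)⁻¹`. -/

namespace OneShot

/-! ### Log-odds, gradients, and the rank-one form of the information matrices -/

section Calculus

variable {ι : Type*} {J : ℕ} (D : Design ι J)

/-- The log-odds of failure, `β_i log (τ_i / α_i)`. -/
noncomputable def logit (θ : Param J) (i : ι) : ℝ :=
  Real.exp (∑ j, θ (Sum.inr j) * D.x i j) * (Real.log (D.τ i) - ∑ j, θ (Sum.inl j) * D.x i j)

/-- The vector of partial derivatives of `logit`. -/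
noncomputable def gradLogit (θ : Param J) (i : ι) : Coord J → ℝ :=
  Sum.elim (fun j => -(shape D θ i * D.x i j)) (fun j => logit D θ i * D.x i j)

theorem logit_eq (θ : Param J) (i : ι) :
    logit D θ i = shape D θ i * Real.log (D.τ i / scale D θ i) := by
  rw [scale, Real.log_div (D.τ_pos i).ne' (Real.exp_pos _).ne', Real.log_exp]
  rfl

/-- The odds of failure are `(τ/α)^β = exp (β log (τ/α))`. This makes the model a logistic
regression with a nonlinear predictor, so that positivity, smoothness and the derivative `F (1 - F)`
all come from the sigmoid. -/
theorem failProb_eq_sigmoid (θ : Param J) (i : ι) :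
    failProb D θ i = Real.sigmoid (logit D θ i) := by
  have hτ := D.τ_pos i
  have hα : 0 < scale D θ i := Real.exp_pos _
  have h1 : Real.exp (-logit D θ i) = scale D θ i ^ shape D θ i / D.τ i ^ shape D θ i := by
    rw [logit_eq, ← Real.div_rpow hα.le hτ.le, Real.rpow_def_of_pos (by positivity),
      Real.log_div hα.ne' hτ.ne', Real.log_div hτ.ne' hα.ne']
    congr 1
    ring
  have := Real.rpow_pos_of_pos hτ (shape D θ i)
  have := Real.rpow_pos_of_pos hα (shape D θ i)
  rw [failProb, loglogisticCDF, Real.sigmoid_def, h1]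
  field_simp

theorem survProb_eq (θ : Param J) (i : ι) : survProb D θ i = 1 - failProb D θ i := by
  have := Real.rpow_pos_of_pos (D.τ_pos i) (shape D θ i)
  have := Real.rpow_pos_of_pos (Real.exp_pos (∑ j, θ (Sum.inl j) * D.x i j)) (shape D θ i)
  rw [failProb, survProb, loglogisticCDF, loglogisticSurv, scale]
  field_simp
  ring

theorem failProb_pos (θ : Param J) (i : ι) : 0 < failProb D θ i := by
  rw [failProb_eq_sigmoid]; exact Real.sigmoid_pos _

theorem failProb_lt_one (θ : Param J) (i : ι) : failProb D θ i < 1 := by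
  rw [failProb_eq_sigmoid]; exact Real.sigmoid_lt_one _

theorem survProb_pos (θ : Param J) (i : ι) : 0 < survProb D θ i := by
  rw [survProb_eq]; linarith [failProb_lt_one D θ i]

theorem param_eq_sum_single (v : Param J) : v = ∑ r, v r • EuclideanSpace.single r (1 : ℝ) := by
  ext s
  rw [WithLp.ofLp_sum, Finset.sum_apply, Finset.sum_eq_single s]
  · simp
  · intro r _ hr
    simp [hr.symm]
  · simp

/-- A differentiable function of the parameter in terms of its partial derivatives. -/
theorem fderiv_apply_eq_sum_grad (f : Param J → ℝ) (θ v : Param J) :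
    fderiv ℝ f θ v = ∑ r, grad f θ r * v r := by
  conv_lhs => rw [param_eq_sum_single v, map_sum]
  refine Finset.sum_congr rfl fun r _ => ?_
  rw [map_smul, smul_eq_mul, mul_comm]
  rfl

theorem continuous_shape (i : ι) : Continuous fun θ => shape D θ i := by
  unfold shape; fun_prop

theorem continuous_logit (i : ι) : Continuous fun θ => logit D θ i := by
  unfold logit; fun_prop

theorem continuous_failProb (i : ι) : Continuous fun θ => failProb D θ i := by
  simp_rw [failProb_eq_sigmoid]
  exact _root_.continuous_sigmoid.comp (continuous_logit D i)

theorem continuous_gradLogit (i : ι) (r : Coord J) : Continuous fun θ => gradLogit D θ i r := by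
  cases r with
  | inl j => exact ((continuous_shape D i).mul continuous_const).neg
  | inr j => exact (continuous_logit D i).mul continuous_const

theorem differentiable_logit (i : ι) : Differentiable ℝ fun θ => logit D θ i := by
  unfold logit; fun_prop

theorem grad_logit (θ : Param J) (i : ι) :
    grad (fun η => logit D η i) θ = gradLogit D θ i := by
  let A : (Fin (J + 1) → Coord J) → Param J →L[ℝ] ℝ := fun u =>
    ∑ j, D.x i j • EuclideanSpace.proj (u j)
  have hA : ∀ (u : Fin (J + 1) → Coord J) (η : Param J), A u η = ∑ j, η (u j) * D.x i j := by
    intro u η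
    simp [A, mul_comm]
  have key : HasFDerivAt (fun η => logit D η i)
      (Real.exp (A Sum.inr θ) • (-(A Sum.inl)) +
        (Real.log (D.τ i) - A Sum.inl θ) • (Real.exp (A Sum.inr θ) • A Sum.inr)) θ := by
    have h := ((A Sum.inr).hasFDerivAt (x := θ)).exp.mul
      ((A Sum.inl).hasFDerivAt (x := θ) |>.const_sub (Real.log (D.τ i)))
    refine h.congr_of_eventuallyEq (Eventually.of_forall fun η => ?_)
    simp only [logit, hA, Pi.mul_apply]
  ext r
  have e1 : ∀ (u : Fin (J + 1) → Coord J), A u (EuclideanSpace.single r 1) =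
      ∑ j, if u j = r then D.x i j else 0 := by
    intro u; rw [hA]
    refine Finset.sum_congr rfl fun j _ => ?_
    by_cases h : u j = r <;> simp [PiLp.single_apply, h]
  rw [grad, key.fderiv]
  simp only [add_apply, smul_apply, neg_apply, e1, smul_eq_mul]
  rw [hA, hA]
  cases r with
  | inl k => simp [gradLogit, shape]
  | inr k => simp [gradLogit, logit]; ring

theorem hasFDerivAt_logit (θ : Param J) (i : ι) :
    HasFDerivAt (fun η => logit D η i) (fderiv ℝ (fun η => logit D η i) θ) θ :=
  (differentiable_logit D i θ).hasFDerivAt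

theorem hasFDerivAt_failProb (θ : Param J) (i : ι) :
    HasFDerivAt (fun η => failProb D η i)
      ((failProb D θ i * survProb D θ i) • fderiv ℝ (fun η => logit D η i) θ) θ := by
  have h := (Real.hasDerivAt_sigmoid (logit D θ i)).comp_hasFDerivAt θ (hasFDerivAt_logit D θ i)
  rw [survProb_eq, failProb_eq_sigmoid]
  exact h.congr_of_eventuallyEq (Eventually.of_forall fun η => failProb_eq_sigmoid D η i)

theorem grad_failProb (θ : Param J) (i : ι) :
    grad (fun η => failProb D η i) θ =
      (failProb D θ i * survProb D θ i) • gradLogit D θ i := by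
  ext r
  rw [grad, (hasFDerivAt_failProb D θ i).fderiv, ← grad_logit]
  rfl

/-- The log-odds have gradient `(-β x, β log (τ/α) x)`; the four blocks are the products of these
two parts, and the minus sign off the diagonal comes from the scale coordinates. -/
theorem blockM_eq (θ : Param J) (i : ι) :
    blockM D θ i = Matrix.vecMulVec (gradLogit D θ i) (gradLogit D θ i) := by
  ext r s
  cases r <;> cases s <;>
    simp [blockM, gradLogit, Matrix.vecMulVec_apply, logit_eq] <;> ring

variable [Fintype ι]

theorem matJ_zero (w : ι → ℝ) (θ : Param J) : matJ D w 0 θ = fisherMat D w θ := by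
  refine Finset.sum_congr rfl fun i _ => ?_
  rw [grad_failProb, blockM_eq, Matrix.smul_vecMulVec, Matrix.vecMulVec_smul, smul_smul, smul_smul,
    zero_sub, Real.rpow_neg_one, Real.rpow_neg_one]
  congr 1
  ring

/-- Because `F + R = 1`, `F⁻¹ + R⁻¹ = (F R)⁻¹`, so the extra factor `F R (F⁻¹ + R⁻¹)` relative to
`matJ` equals one. -/
theorem matK_zero (w : ι → ℝ) (θ : Param J) : matK D w 0 θ = fisherMat D w θ := by
  refine Finset.sum_congr rfl fun i _ => ?_
  rw [grad_failProb, blockM_eq, Matrix.smul_vecMulVec, Matrix.vecMulVec_smul, smul_smul, smul_smul,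
    zero_sub, Real.rpow_neg_one, Real.rpow_neg_one]
  have hF := failProb_pos D θ i
  have hR := survProb_pos D θ i
  have h1 : survProb D θ i = 1 - failProb D θ i := survProb_eq D θ i
  congr 1
  have h2 : (failProb D θ i)⁻¹ + (survProb D θ i)⁻¹ =
      (failProb D θ i * survProb D θ i)⁻¹ := by
    rw [h1] at hR ⊢
    field_simp
    ring
  rw [h2]
  field_simp

/-- The scalar weight collapses to the Bernoulli variance `F R`, again by `F + R = 1`. The later
arguments use the information matrix in this form. -/
theorem fisherMat_eq (w : ι → ℝ) (θ : Param J) :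
    fisherMat D w θ = ∑ i, (w i * (failProb D θ i * survProb D θ i)) •
      Matrix.vecMulVec (gradLogit D θ i) (gradLogit D θ i) := by
  refine Finset.sum_congr rfl fun i _ => ?_
  rw [blockM_eq]
  have hF := failProb_pos D θ i
  have hR := survProb_pos D θ i
  have h1 : survProb D θ i = 1 - failProb D θ i := survProb_eq D θ i
  congr 2
  field_simp
  linarith

theorem fisherMat_apply (w : ι → ℝ) (θ : Param J) (r s : Coord J) :
    fisherMat D w θ r s = ∑ i, w i * (failProb D θ i * survProb D θ i) *
      (gradLogit D θ i r * gradLogit D θ i s) := by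
  simp [fisherMat_eq, Matrix.sum_apply, Matrix.vecMulVec_apply]

theorem fisherMat_posSemidef {w : ι → ℝ} (hw : ∀ i, 0 ≤ w i) (θ : Param J) :
    (fisherMat D w θ).PosSemidef := by
  rw [fisherMat_eq]
  refine Matrix.posSemidef_sum _ fun i _ => ?_
  have := Matrix.posSemidef_vecMulVec_self_star (gradLogit D θ i)
  exact this.smul (mul_nonneg (hw i)
    (mul_pos (failProb_pos D θ i) (survProb_pos D θ i)).le)

theorem logLik_eq {K c : ι → ℕ} (hc : ∀ i, c i ≤ K i) (θ : Param J) :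
    logLik D K c θ = ∑ i, ((c i : ℝ) * Real.log (failProb D θ i) +
      ((K i : ℝ) - c i) * Real.log (survProb D θ i)) := by
  rw [logLik, Real.log_prod]
  · refine Finset.sum_congr rfl fun i _ => ?_
    rw [Real.log_mul (pow_pos (failProb_pos D θ i) _).ne' (pow_pos (survProb_pos D θ i) _).ne',
      Real.log_pow, Real.log_pow, Nat.cast_sub (hc i)]
  · exact fun i _ => (mul_pos (pow_pos (failProb_pos D θ i) _)
      (pow_pos (survProb_pos D θ i) _)).ne'

theorem continuous_logLik {K c : ι → ℕ} : Continuous (logLik D K c) := by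
  have h1 := continuous_failProb D
  unfold logLik
  simp_rw [survProb_eq]
  refine Continuous.log (by fun_prop) fun θ => ?_
  simp_rw [← survProb_eq]
  exact (Finset.prod_pos fun i _ => mul_pos (pow_pos (failProb_pos D θ i) _)
      (pow_pos (survProb_pos D θ i) _)).ne'

/-- The score vector. -/
theorem grad_logLik {K c : ι → ℕ} (hc : ∀ i, c i ≤ K i) (θ : Param J) (r : Coord J) :
    grad (logLik D K c) θ r = ∑ i, ((c i : ℝ) - K i * failProb D θ i) * gradLogit D θ i r := by
  have h : HasFDerivAt (logLik D K c) (∑ i, ((c i : ℝ) - K i * failProb D θ i) •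
      fderiv ℝ (fun η => logit D η i) θ) θ := by
    have h1 : HasFDerivAt (fun η => ∑ i, ((c i : ℝ) * Real.log (failProb D η i) +
      ((K i : ℝ) - c i) * Real.log (survProb D η i))) (∑ i, ((c i : ℝ) - K i * failProb D θ i) •
      fderiv ℝ (fun η => logit D η i) θ) θ := by
      refine HasFDerivAt.fun_sum fun i _ => ?_
      have hF := hasFDerivAt_failProb D θ i
      have hR : HasFDerivAt (fun η => survProb D η i)
          (-((failProb D θ i * survProb D θ i) • fderiv ℝ (fun η => logit D η i) θ)) θ := by
        simp_rw [survProb_eq D _ i] at hF ⊢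
        exact hF.const_sub 1
      have h2 := ((hF.log (failProb_pos D θ i).ne').const_mul (c i : ℝ)).add
        ((hR.log (survProb_pos D θ i).ne').const_mul ((K i : ℝ) - c i))
      refine h2.congr_fderiv ?_
      rw [← neg_smul]
      simp only [smul_smul, ← add_smul]
      congr 1
      have hF := failProb_pos D θ i
      have hR := survProb_pos D θ i
      have h1 : failProb D θ i = 1 - survProb D θ i := by rw [survProb_eq]; ring
      field_simp
      rw [h1]
      ring
    exact h1.congr_of_eventuallyEq (Eventually.of_forall fun η => logLik_eq D hc η)
  rw [grad, h.fderiv]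
  simp_rw [← grad_logit]
  simp [grad]

end Calculus

/-! ### The distribution function of the log-logistic law -/

section Law

theorem loglogisticMeasure_Iic {α β t : ℝ} (hα : 0 < α) (hβ : 0 < β) (ht : 0 < t) :
    loglogisticMeasure α β (Set.Iic t) = ENNReal.ofReal (loglogisticCDF α β t) := by
  have hA : 0 < α ^ β := Real.rpow_pos_of_pos hα β
  have hden : ∀ x : ℝ, 0 ≤ x → x ^ β + α ^ β ≠ 0 := fun x hx =>
    (add_pos_of_nonneg_of_pos (Real.rpow_nonneg hx β) hA).ne'
  have hcont : ContinuousOn (loglogisticCDF α β) (Set.Icc 0 t) := by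
    have h : Continuous fun x : ℝ => x ^ β := Real.continuous_rpow_const hβ.le
    exact h.continuousOn.div (by fun_prop) fun x hx => hden x hx.1
  have hderiv : ∀ x ∈ Set.Ioo 0 t, HasDerivAt (loglogisticCDF α β) (loglogisticPDF α β x) x := by
    intro x hx
    have h := Real.hasDerivAt_rpow_const (x := x) (p := β) (Or.inl hx.1.ne')
    refine (h.div (h.add_const (α ^ β)) (hden x hx.1.le)).congr_deriv ?_
    rw [loglogisticPDF, if_pos hx.1]
    congr 1
    ring
  have hnn : ∀ x, 0 ≤ loglogisticPDF α β x := by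
    intro x
    unfold loglogisticPDF
    split_ifs with hx
    · positivity
    · exact le_rfl
  -- For `β < 1` the density is unbounded near `0`. It is integrable as the nonnegative derivative
  -- of a function continuous up to the endpoint.
  have hint := intervalIntegral.integrableOn_deriv_of_nonneg hcont hderiv fun x _ => hnn x
  have hval := intervalIntegral.integral_eq_sub_of_hasDerivAt_of_le ht.le hcont hderiv
    ((intervalIntegrable_iff_integrableOn_Ioc_of_le ht.le).2 hint)
  rw [intervalIntegral.integral_of_le ht.le] at hval
  have h0 : loglogisticCDF α β 0 = 0 := by simp [loglogisticCDF, Real.zero_rpow hβ.ne']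
  rw [loglogisticMeasure, withDensity_apply _ measurableSet_Iic, ← sub_zero (loglogisticCDF α β t),
    ← h0, ← hval, ofReal_integral_eq_lintegral_ofReal hint (Eventually.of_forall hnn),
    ← Set.Iic_union_Ioc_eq_Iic ht.le, lintegral_union measurableSet_Ioc
      (Set.Iic_disjoint_Ioc le_rfl)]
  rw [setLIntegral_congr_fun (g := fun _ => 0) measurableSet_Iic]
  · simp
  · intro x hx
    simp [loglogisticPDF, not_lt.2 (Set.mem_Iic.1 hx)]

end Law

/-! ### Moments of the failure counts, the score covariance, and Chebyshev's bound -/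

section Deviations

variable {ι : Type*} {J : ℕ} (D : Design ι J) (θ₀ : Param J) {Ω : Type*}
  (T : ι → ℕ → Ω → ℝ)

/-- The centred failure indicator of device `q.2` under condition `q.1`. -/
noncomputable def deviation (q : Σ _ : ι, ℕ) (ω : Ω) : ℝ :=
  (if T q.1 q.2 ω ≤ D.τ q.1 then 1 else 0) - failProb D θ₀ q.1

theorem failures_le (K : ι → ℕ) (ω : Ω) (i : ι) : failures D T K ω i ≤ K i := by
  simpa [failures] using Finset.card_filter_le (Finset.range (K i)) fun k => T i k ω ≤ D.τ i

theorem failures_sub_mean (K : ι → ℕ) (ω : Ω) (i : ι) :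
    (failures D T K ω i : ℝ) - K i * failProb D θ₀ i =
      ∑ k ∈ Finset.range (K i), deviation D θ₀ T ⟨i, k⟩ ω := by
  simp [failures, deviation, Finset.sum_sub_distrib]

theorem abs_deviation_le (q : Σ _ : ι, ℕ) (ω : Ω) : |deviation D θ₀ T q ω| ≤ 1 := by
  have h0 := failProb_pos D θ₀ q.1
  have h1 := failProb_lt_one D θ₀ q.1
  unfold deviation
  split_ifs <;> rw [abs_le] <;> constructor <;> linarith

variable [MeasurableSpace Ω] {P : Measure Ω}

theorem aemeasurable_failures (hT : ∀ i k, AEMeasurable (T i k) P) (K : ι → ℕ) [Countable ι] :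
    AEMeasurable (failures D T K) P := by
  refine aemeasurable_pi_lambda _ fun i => ?_
  simp only [failures, Finset.card_filter]
  refine Finset.aemeasurable_fun_sum _ fun k _ => ?_
  exact (Measurable.ite measurableSet_Iic measurable_const measurable_const).comp_aemeasurable
    (hT i k) (g := fun s : ℝ => if s ≤ D.τ i then 1 else 0)

theorem measurable_deviation_aux (i : ι) :
    Measurable fun s : ℝ => (if s ≤ D.τ i then (1 : ℝ) else 0) - failProb D θ₀ i :=
  (Measurable.ite measurableSet_Iic measurable_const measurable_const).sub_const _

theorem aemeasurable_deviation (hT : ∀ i k, AEMeasurable (T i k) P) (q : Σ _ : ι, ℕ) :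
    AEMeasurable (deviation D θ₀ T q) P :=
  (measurable_deviation_aux D θ₀ q.1).comp_aemeasurable (hT q.1 q.2)

/-- Reindexing by a sigma type suits groups of unequal sizes: the devices on test form a
`Finset.sigma`. -/
theorem iIndepFun_deviation (hind : iIndepFun (fun q : ι × ℕ => T q.1 q.2) P) :
    iIndepFun (deviation D θ₀ T) P := by
  have h := hind.precomp (g := fun q : Σ _ : ι, ℕ => (q.1, q.2)) (by
    rintro ⟨a, b⟩ ⟨c, d⟩ h
    simpa using h)
  exact h.comp (fun q s => (if s ≤ D.τ q.1 then (1 : ℝ) else 0) - failProb D θ₀ q.1)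
    fun q => measurable_deviation_aux D θ₀ q.1

variable {T} [IsProbabilityMeasure P]
  (hlaw : ∀ i k, HasLaw (T i k) (loglogisticMeasure (scale D θ₀ i) (shape D θ₀ i)) P)
include hlaw

omit [IsProbabilityMeasure P] in
theorem map_deviation (i : ι) (k : ℕ) :
    P.map (deviation D θ₀ T ⟨i, k⟩) = P.map (deviation D θ₀ T ⟨i, 0⟩) := by
  have h : ∀ k, P.map (deviation D θ₀ T ⟨i, k⟩) =
      (loglogisticMeasure (scale D θ₀ i) (shape D θ₀ i)).map
        fun s : ℝ => (if s ≤ D.τ i then (1 : ℝ) else 0) - failProb D θ₀ i := by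
    intro k
    rw [← (hlaw i k).map_eq, AEMeasurable.map_map_of_aemeasurable
      (measurable_deviation_aux D θ₀ i).aemeasurable (hlaw i k).aemeasurable]
    rfl
  rw [h, h]

theorem memLp_deviation (q : Σ _ : ι, ℕ) (p : ENNReal) : MemLp (deviation D θ₀ T q) p P :=
  MemLp.of_bound
    (aemeasurable_deviation D θ₀ T (fun i k => (hlaw i k).aemeasurable) q).aestronglyMeasurable 1
    (Eventually.of_forall fun ω => abs_deviation_le D θ₀ T q ω)

omit [IsProbabilityMeasure P] in
theorem integral_indicator_failure (i : ι) (k : ℕ) :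
    ∫ ω, (if T i k ω ≤ D.τ i then (1 : ℝ) else 0) ∂P = failProb D θ₀ i := by
  have h := integral_map (hlaw i k).aemeasurable (μ := P)
    (f := fun s : ℝ => if s ≤ D.τ i then (1 : ℝ) else 0)
    (Measurable.ite measurableSet_Iic measurable_const measurable_const).aestronglyMeasurable
  rw [← h, (hlaw i k).map_eq]
  have h2 : (fun s : ℝ => if s ≤ D.τ i then (1 : ℝ) else 0) =
      (Set.Iic (D.τ i)).indicator 1 := by
    ext s; simp [Set.indicator_apply]
  have hα : 0 < scale D θ₀ i := Real.exp_pos _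
  have hβ : 0 < shape D θ₀ i := Real.exp_pos _
  rw [h2, integral_indicator_one measurableSet_Iic, measureReal_def,
    loglogisticMeasure_Iic hα hβ (D.τ_pos i)]
  exact ENNReal.toReal_ofReal (failProb_pos D θ₀ i).le

theorem integrable_indicator_failure (i : ι) (k : ℕ) :
    Integrable (fun ω => if T i k ω ≤ D.τ i then (1 : ℝ) else 0) P := by
  have h := ((memLp_deviation D θ₀ hlaw ⟨i, k⟩ 1).integrable le_rfl).add
    (integrable_const (failProb D θ₀ i))
  refine h.congr (Eventually.of_forall fun ω => ?_)
  simp [deviation]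

theorem integral_deviation (q : Σ _ : ι, ℕ) : ∫ ω, deviation D θ₀ T q ω ∂P = 0 := by
  simp only [deviation]
  rw [integral_sub (integrable_indicator_failure D θ₀ hlaw _ _) (integrable_const _),
    integral_indicator_failure D θ₀ hlaw]
  simp

theorem integral_deviation_sq (q : Σ _ : ι, ℕ) :
    ∫ ω, deviation D θ₀ T q ω ^ 2 ∂P = failProb D θ₀ q.1 * survProb D θ₀ q.1 := by
  have h : ∀ ω, deviation D θ₀ T q ω ^ 2 = (1 - 2 * failProb D θ₀ q.1) *
      (if T q.1 q.2 ω ≤ D.τ q.1 then (1 : ℝ) else 0) + failProb D θ₀ q.1 ^ 2 := by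
    intro ω
    unfold deviation
    split_ifs <;> ring
  simp_rw [h]
  rw [integral_add ((integrable_indicator_failure D θ₀ hlaw _ _).const_mul _)
    (integrable_const _), integral_const_mul, integral_indicator_failure D θ₀ hlaw, survProb_eq]
  simp
  ring

variable (hind : iIndepFun (fun q : ι × ℕ => T q.1 q.2) P)
include hind

theorem integral_deviation_mul [DecidableEq ι] (q q' : Σ _ : ι, ℕ) :
    ∫ ω, deviation D θ₀ T q ω * deviation D θ₀ T q' ω ∂P =
      if q = q' then failProb D θ₀ q.1 * survProb D θ₀ q.1 else 0 := by
  split_ifs with h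
  · subst h
    simp_rw [← pow_two]
    exact integral_deviation_sq D θ₀ hlaw q
  · rw [((iIndepFun_deviation D θ₀ T hind).indepFun h).integral_fun_mul_eq_mul_integral
      (memLp_deviation D θ₀ hlaw q 1).aestronglyMeasurable
      (memLp_deviation D θ₀ hlaw q' 1).aestronglyMeasurable, integral_deviation D θ₀ hlaw, zero_mul]

omit hind in
theorem integrable_deviation_mul (q q' : Σ _ : ι, ℕ) :
    Integrable (fun ω => deviation D θ₀ T q ω * deviation D θ₀ T q' ω) P :=
  (memLp_deviation D θ₀ hlaw q 2).integrable_mul (memLp_deviation D θ₀ hlaw q' 2)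

omit hind in
theorem integrable_failures_mul (K : ι → ℕ) (i j : ι) :
    Integrable (fun ω => ((failures D T K ω i : ℝ) - K i * failProb D θ₀ i) *
      ((failures D T K ω j : ℝ) - K j * failProb D θ₀ j)) P := by
  simp_rw [failures_sub_mean, Finset.sum_mul_sum]
  exact integrable_finsetSum _ fun k _ => integrable_finsetSum _ fun l _ =>
    integrable_deviation_mul D θ₀ hlaw _ _

theorem integral_failures_mul [DecidableEq ι] (K : ι → ℕ) (i j : ι) :
    ∫ ω, ((failures D T K ω i : ℝ) - K i * failProb D θ₀ i) *
      ((failures D T K ω j : ℝ) - K j * failProb D θ₀ j) ∂P =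
      if i = j then K i * (failProb D θ₀ i * survProb D θ₀ i) else 0 := by
  simp_rw [failures_sub_mean, Finset.sum_mul_sum]
  rw [integral_finsetSum _ fun k _ => integrable_finsetSum _ fun l _ =>
    integrable_deviation_mul D θ₀ hlaw _ _]
  simp_rw [integral_finsetSum _ fun l _ => integrable_deviation_mul D θ₀ hlaw _ _,
    integral_deviation_mul D θ₀ hlaw hind]
  split_ifs with h
  · subst h
    simp only [Sigma.mk.injEq, heq_eq_eq, true_and, Finset.sum_ite_eq]
    exact (Finset.sum_congr rfl fun k hk => if_pos hk).trans (by simp)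
  · simp [h]

variable [Fintype ι]

/-- The covariance matrix of the score is the Fisher information matrix. -/
theorem integral_score_mul_score (K : ι → ℕ) (r s : Coord J) :
    ∫ ω, grad (logLik D K (failures D T K ω)) θ₀ r *
      grad (logLik D K (failures D T K ω)) θ₀ s ∂P =
      (total K : ℝ) * fisherMat D (prop K) θ₀ r s := by
  classical
  have hg : ∀ ω r, grad (logLik D K (failures D T K ω)) θ₀ r = _ := fun ω r =>
    grad_logLik D (fun i => failures_le D T K ω i) θ₀ r
  have hrw : ∀ ω, grad (logLik D K (failures D T K ω)) θ₀ r *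
      grad (logLik D K (failures D T K ω)) θ₀ s = ∑ i, ∑ j,
        (gradLogit D θ₀ i r * gradLogit D θ₀ j s) *
        (((failures D T K ω i : ℝ) - K i * failProb D θ₀ i) *
          ((failures D T K ω j : ℝ) - K j * failProb D θ₀ j)) := by
    intro ω
    rw [hg, hg, Finset.sum_mul_sum]
    refine Finset.sum_congr rfl fun i _ => Finset.sum_congr rfl fun j _ => ?_
    ring
  simp_rw [hrw]
  rw [integral_finsetSum _ fun i _ => integrable_finsetSum _ fun j _ =>
    (integrable_failures_mul D θ₀ hlaw K i j).const_mul _]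
  simp_rw [integral_finsetSum _ fun j _ =>
    (integrable_failures_mul D θ₀ hlaw K _ j).const_mul _, integral_const_mul,
    integral_failures_mul D θ₀ hlaw hind, mul_ite, mul_zero, Finset.sum_ite_eq, Finset.mem_univ,
    if_true]
  rw [fisherMat_apply, Finset.mul_sum]
  refine Finset.sum_congr rfl fun i _ => ?_
  -- This holds even with no devices at all: then `K i = 0` as well, and both sides vanish.
  have hK : (K i : ℝ) = total K * prop K i := by
    rcases Nat.eq_zero_or_pos (total K) with h | h
    · have : K i ≤ total K := Finset.single_le_sum (fun _ _ => Nat.zero_le _) (Finset.mem_univ i)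
      have h0 : K i = 0 := by omega
      simp [h, h0]
    · have : (0 : ℝ) < total K := by exact_mod_cast h
      rw [prop]; field_simp
  rw [hK]
  ring

/-- Chebyshev: the variance `K_i F_i R_i` is at most the total `K`, so each probability is at most
`1 / (η² K)`, and there are finitely many conditions. Normalizing by the total rather than by `K_i`
covers conditions whose own sample size stays bounded. -/
theorem tendsto_measure_deviation_gt (K : ℕ → ι → ℕ)
    (hK : Tendsto (fun n => total (K n)) atTop atTop) {η : ℝ} (hη : 0 < η) :
    Tendsto (fun n => P {ω | ∃ i, η * total (K n) <
      |(failures D T (K n) ω i : ℝ) - K n i * failProb D θ₀ i|}) atTop (𝓝 0) := by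
  classical
  have hN : Tendsto (fun n => (total (K n) : ℝ)) atTop atTop :=
    tendsto_natCast_atTop_atTop.comp hK
  have hone : ∀ i, Tendsto (fun n => P {ω | η * total (K n) <
      |(failures D T (K n) ω i : ℝ) - K n i * failProb D θ₀ i|}) atTop (𝓝 0) := by
    intro i
    have hlim : Tendsto (fun n => ENNReal.ofReal (1 / (η ^ 2 * total (K n)))) atTop (𝓝 0) := by
      rw [← ENNReal.ofReal_zero]
      refine ENNReal.tendsto_ofReal ?_
      simp_rw [one_div]
      exact (hN.const_mul_atTop (by positivity)).inv_tendsto_atTop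
    refine tendsto_of_tendsto_of_tendsto_of_le_of_le' tendsto_const_nhds hlim
      (Eventually.of_forall fun _ => zero_le) ?_
    filter_upwards [hN.eventually_gt_atTop 0] with n hn
    have hm := mul_meas_ge_le_integral_of_nonneg (μ := P)
      (f := fun ω => ((failures D T (K n) ω i : ℝ) - K n i * failProb D θ₀ i) *
        ((failures D T (K n) ω i : ℝ) - K n i * failProb D θ₀ i))
      (Eventually.of_forall fun ω => mul_self_nonneg _)
      (integrable_failures_mul D θ₀ hlaw (K n) i i) ((η * total (K n)) ^ 2)
    rw [integral_failures_mul D θ₀ hlaw hind, if_pos rfl] at hm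
    have hF := failProb_pos D θ₀ i
    have hR := survProb_pos D θ₀ i
    have hFR : failProb D θ₀ i * survProb D θ₀ i ≤ 1 := by
      rw [survProb_eq] at hR ⊢
      nlinarith
    have hKN : (K n i : ℝ) ≤ total (K n) := by
      exact_mod_cast Finset.single_le_sum (f := K n) (fun _ _ => Nat.zero_le _) (Finset.mem_univ i)
    have hb : (K n i : ℝ) * (failProb D θ₀ i * survProb D θ₀ i) ≤ total (K n) := by
      calc _ ≤ (K n i : ℝ) * 1 := by gcongr
        _ ≤ _ := by linarith
    have hm2 := hm.trans hb
    rw [← ofReal_measureReal]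
    refine ENNReal.ofReal_le_ofReal ?_
    refine (measureReal_mono (fun ω hω => ?_)).trans
      ((le_div_iff₀' (by positivity)).2 hm2 |>.trans (le_of_eq ?_))
    · simp only [Set.mem_ofPred_eq] at hω ⊢
      rw [← pow_two, ← sq_abs (_ - _)]
      gcongr
    · field_simp
  have hsum : Tendsto (fun n => ∑ i, P {ω | η * total (K n) <
      |(failures D T (K n) ω i : ℝ) - K n i * failProb D θ₀ i|}) atTop (𝓝 0) := by
    simpa using tendsto_finsetSum Finset.univ fun i _ => hone i
  refine tendsto_of_tendsto_of_tendsto_of_le_of_le tendsto_const_nhds hsum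
    (fun _ => zero_le) fun n => ?_
  simp only [Set.ofPred_exists]
  exact measure_iUnion_fintype_le _ _

end Deviations

/-! ### Central limit theorem for the counts, with group sizes varying along the sequence -/

section CentralLimit

/-- `log (1 + z)` is `z` times a slope of the logarithm that tends to `1`, so `m log (1 + z)` has
the same limit as `m z`. The exponents need not tend to infinity, which matters for groups with
limiting proportion zero. -/
theorem tendsto_one_add_pow_cexp {z : ℕ → ℂ} {m : ℕ → ℕ} {L : ℂ} (hz : Tendsto z atTop (𝓝 0))
    (hm : Tendsto (fun n => (m n : ℂ) * z n) atTop (𝓝 L)) :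
    Tendsto (fun n => (1 + z n) ^ m n) atTop (𝓝 (Complex.exp L)) := by
  have hd : ContinuousAt (dslope Complex.log 1) 1 := by
    rw [continuousAt_dslope_same]
    exact (Complex.hasDerivAt_log (by simp)).differentiableAt
  have h1 : Tendsto (fun n => 1 + z n) atTop (𝓝 1) := by simpa using hz.const_add 1
  have h2 : Tendsto (fun n => (m n : ℂ) * z n * dslope Complex.log 1 (1 + z n)) atTop (𝓝 L) := by
    have h3 : dslope Complex.log 1 1 = 1 := by
      rw [dslope_same, (Complex.hasDerivAt_log (by simp)).deriv]
      simp
    have h4 := hm.mul (hd.tendsto.comp h1)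
    rwa [h3, mul_one] at h4
  have hne : ∀ᶠ n in atTop, 1 + z n ≠ 0 := h1.eventually_ne one_ne_zero
  refine (Complex.continuous_exp.tendsto L |>.comp h2).congr' ?_
  filter_upwards [hne] with n hn
  have h5 := sub_smul_dslope Complex.log 1 (1 + z n)
  rw [add_sub_cancel_left, smul_eq_mul, Complex.log_one, sub_zero] at h5
  rw [Function.comp_apply, mul_assoc, h5, Complex.exp_nat_mul, Complex.exp_log hn]

/-- Powers of the characteristic function of a centred variable of variance `v`, at arguments that
tend to zero, converge to a Gaussian characteristic function. -/
theorem tendsto_charFun_pow {Ω : Type*} [MeasurableSpace Ω] {P : Measure Ω}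
    [IsProbabilityMeasure P] {X : Ω → ℝ} (hX : AEMeasurable X P) {v : ℝ} (hv : 0 < v)
    (h0 : ∫ ω, X ω ∂P = 0) (h1 : ∫ ω, X ω ^ 2 ∂P = v) {s : ℕ → ℝ} {m : ℕ → ℕ} {a : ℝ}
    (hs : Tendsto s atTop (𝓝 0)) (hm : Tendsto (fun n => (m n : ℝ) * s n ^ 2) atTop (𝓝 a)) :
    Tendsto (fun n => charFun (P.map X) (s n) ^ m n) atTop
      (𝓝 (Complex.exp (-(v * a : ℝ) / 2))) := by
  have hsv : 0 < Real.sqrt v := Real.sqrt_pos.2 hv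
  -- Rescaling to unit variance makes `taylor_charFun_two` applicable.
  set Y : Ω → ℝ := fun ω => (Real.sqrt v)⁻¹ * X ω with hY
  have hYm : AEMeasurable Y P := hX.const_mul _
  have hY0 : ∫ ω, Y ω ∂P = 0 := by rw [integral_const_mul, h0, mul_zero]
  have hY1 : ∫ ω, (Y ^ 2) ω ∂P = 1 := by
    simp only [Pi.pow_apply, hY, mul_pow]
    rw [integral_const_mul, h1, inv_pow, Real.sq_sqrt hv.le, inv_mul_cancel₀ hv.ne']
  have hXY : ∀ t, charFun (P.map X) t = charFun (P.map Y) (Real.sqrt v * t) := by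
    intro t
    rw [hY, charFun_map_mul_comp hX, ← mul_assoc, inv_mul_cancel₀ hsv.ne', one_mul]
  have ht : Tendsto (fun n => Real.sqrt v * s n) atTop (𝓝 0) := by simpa using hs.const_mul _
  have ho := ((taylor_charFun_two hYm hY0 hY1).trans_isBigO
    (Asymptotics.isBigO_of_le (g := fun t : ℝ => ((t ^ 2 : ℝ) : ℂ)) _
      fun t => by simp)).tendsto_div_nhds_zero.comp ht
  have hprob : IsProbabilityMeasure (P.map Y) := Measure.isProbabilityMeasure_map hYm
  -- `ρ` is the second-order Taylor remainder divided by `v s²`; where `s = 0` both sides vanish,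
  -- whatever the value of `ρ`.
  obtain ⟨ρ, hρ, hid⟩ : ∃ ρ : ℕ → ℂ, Tendsto ρ atTop (𝓝 0) ∧ ∀ n,
      (charFun (P.map X) (s n) - 1) = ((s n ^ 2 * v : ℝ) : ℂ) * (-(1 / 2) + ρ n) := by
    refine ⟨_, ho, fun n => ?_⟩
    simp only [Function.comp_apply]
    rw [hXY]
    by_cases h : s n = 0
    · simp [h]
    have hsq : (Real.sqrt v * s n) ^ 2 = s n ^ 2 * v := by
      rw [mul_pow, Real.sq_sqrt hv.le, mul_comm]
    have hne : ((s n ^ 2 * v : ℝ) : ℂ) ≠ 0 := by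
      exact_mod_cast (mul_pos (pow_pos (abs_pos.2 h) 2) hv |>.trans_eq (by rw [sq_abs])).ne'
    rw [← Complex.ofReal_pow, hsq]
    field_simp
    ring
  have hz : Tendsto (fun n => charFun (P.map X) (s n) - 1) atTop (𝓝 0) := by
    simp_rw [hid]
    have e1 : Tendsto (fun n => ((s n ^ 2 * v : ℝ) : ℂ)) atTop (𝓝 0) := by
      have h2 : Tendsto (fun n => s n ^ 2 * v) atTop (𝓝 0) := by
        simpa using (hs.pow 2).mul_const v
      rw [← Complex.ofReal_zero]
      exact (Complex.continuous_ofReal.tendsto 0).comp h2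
    have e2 := e1.mul (hρ.const_add (-(1 / 2)))
    rwa [zero_mul] at e2
  have hL : Tendsto (fun n => (m n : ℂ) * (charFun (P.map X) (s n) - 1)) atTop
      (𝓝 (-(v * a : ℝ) / 2)) := by
    simp_rw [hid]
    have e1 : Tendsto (fun n => (((m n : ℝ) * s n ^ 2 * v : ℝ) : ℂ)) atTop (𝓝 ((a * v : ℝ) : ℂ)) :=
      (Complex.continuous_ofReal.tendsto _).comp (hm.mul_const v)
    have e2 := e1.mul (hρ.const_add (-(1 / 2)))
    convert e2 using 2
    · push_cast; ring
    · push_cast; ring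
  simpa using tendsto_one_add_pow_cexp hz hL

variable {ι : Type*} [Fintype ι] {J : ℕ} (D : Design ι J) (θ₀ : Param J) {Ω : Type*}
  [MeasurableSpace Ω] {P : Measure Ω} [IsProbabilityMeasure P] {T : ι → ℕ → Ω → ℝ}

/-- The vector of the normalized counts `(n_i - K_i F_i(θ₀)) / √K`. -/
noncomputable def normalizedCounts (K c : ι → ℕ) : EuclideanSpace ℝ ι :=
  WithLp.toLp 2 fun i => (Real.sqrt (total K))⁻¹ * ((c i : ℝ) - K i * failProb D θ₀ i)

/-- The covariance matrix of the limit law of the normalized counts. -/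
noncomputable def countsCov [DecidableEq ι] (p : ι → ℝ) : Matrix ι ι ℝ :=
  Matrix.diagonal fun i => p i * (failProb D θ₀ i * survProb D θ₀ i)

omit [Fintype ι] in
theorem countsCov_posSemidef [DecidableEq ι] {p : ι → ℝ} (hp : ∀ i, 0 ≤ p i) :
    (countsCov D θ₀ p).PosSemidef :=
  Matrix.PosSemidef.diagonal fun i =>
    mul_nonneg (hp i) (mul_pos (failProb_pos D θ₀ i) (survProb_pos D θ₀ i)).le

omit [IsProbabilityMeasure P] in
theorem aemeasurable_comp_failures (hT : ∀ i k, AEMeasurable (T i k) P) (K : ι → ℕ)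
    {E : Type*} [MeasurableSpace E] (f : (ι → ℕ) → E) :
    AEMeasurable (fun ω => f (failures D T K ω)) P :=
  (Measurable.of_discrete (f := f)).comp_aemeasurable (aemeasurable_failures D T hT K)

variable (hlaw : ∀ i k, HasLaw (T i k) (loglogisticMeasure (scale D θ₀ i) (shape D θ₀ i)) P)
  (hind : iIndepFun (fun q : ι × ℕ => T q.1 q.2) P)
include hlaw hind

omit [IsProbabilityMeasure P] in
theorem charFun_normalizedCounts (K : ι → ℕ) (t : EuclideanSpace ℝ ι) :
    charFun (P.map fun ω => normalizedCounts D θ₀ K (failures D T K ω)) t =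
      ∏ i, charFun (P.map (deviation D θ₀ T ⟨i, 0⟩)) (t i * (Real.sqrt (total K))⁻¹) ^ K i := by
  have hT : ∀ i k, AEMeasurable (T i k) P := fun i k => (hlaw i k).aemeasurable
  have hdev := aemeasurable_deviation D θ₀ T hT
  set N := (Real.sqrt (total K))⁻¹
  have h1 : ∀ ω, inner ℝ (normalizedCounts D θ₀ K (failures D T K ω)) t =
      ∑ q ∈ Finset.univ.sigma fun i => Finset.range (K i),
        (t q.1 * N) * deviation D θ₀ T q ω := by
    intro ω
    rw [Finset.sum_sigma, PiLp.inner_apply]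
    refine Finset.sum_congr rfl fun i _ => ?_
    dsimp only
    rw [← Finset.mul_sum, ← failures_sub_mean]
    simp only [normalizedCounts, RCLike.inner_apply, conj_trivial]
    ring
  -- The characteristic function of a vector at `t` is that of its inner product with `t` at `1`,
  -- and this inner product is a sum of independent real terms.
  have h2 : charFun (P.map fun ω => normalizedCounts D θ₀ K (failures D T K ω)) t =
      charFun (P.map fun ω => ∑ q ∈ Finset.univ.sigma fun i => Finset.range (K i),
        (t q.1 * N) * deviation D θ₀ T q ω) 1 := by
    rw [charFun_apply, charFun_apply, integral_map
      (aemeasurable_comp_failures D hT K _) (by fun_prop), integral_map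
      (Finset.aemeasurable_fun_sum _ fun q _ => (hdev q).const_mul _) (by fun_prop)]
    refine integral_congr_ae (Eventually.of_forall fun ω => ?_)
    simp only [h1]
    simp
  have hind' : iIndepFun (fun q ω => (t q.1 * N) * deviation D θ₀ T q ω) P :=
    (iIndepFun_deviation D θ₀ T hind).comp (fun q s => (t q.1 * N) * s)
      fun q => measurable_const_mul _
  rw [h2, iIndepFun.charFun_map_fun_finsetSum_eq_prod (fun q _ => (hdev q).const_mul _)
    (hind'.restrict _), Finset.prod_sigma, Finset.prod_apply]
  refine Finset.prod_congr rfl fun i _ => ?_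
  rw [Finset.prod_apply]
  simp_rw [charFun_map_mul_comp (hdev _), mul_one, map_deviation D θ₀ hlaw]
  simp

/-- **Central limit theorem** for the failure counts. -/
theorem tendstoInDistribution_normalizedCounts [DecidableEq ι] (K : ℕ → ι → ℕ)
    (hK : Tendsto (fun n => total (K n)) atTop atTop) (p : ι → ℝ)
    (hp : ∀ i, Tendsto (fun n => prop (K n) i) atTop (𝓝 (p i))) :
    TendstoInDistribution (fun n ω => normalizedCounts D θ₀ (K n) (failures D T (K n) ω)) atTop
      (id : EuclideanSpace ℝ ι → EuclideanSpace ℝ ι) (fun _ => P)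
      (multivariateGaussian 0 (countsCov D θ₀ p)) := by
  have hT : ∀ i k, AEMeasurable (T i k) P := fun i k => (hlaw i k).aemeasurable
  have hp0 : ∀ i, 0 ≤ p i := fun i =>
    ge_of_tendsto' (hp i) fun n => div_nonneg (Nat.cast_nonneg _) (Nat.cast_nonneg _)
  have hN : Tendsto (fun n => (total (K n) : ℝ)) atTop atTop :=
    tendsto_natCast_atTop_atTop.comp hK
  refine ⟨fun n => aemeasurable_comp_failures D hT (K n) _, aemeasurable_id, ?_⟩
  refine ProbabilityMeasure.tendsto_of_tendsto_charFun fun t => ?_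
  simp only [ProbabilityMeasure.coe_mk, Measure.map_id]
  rw [charFun_multivariateGaussian (countsCov_posSemidef D θ₀ hp0)]
  simp_rw [charFun_normalizedCounts D θ₀ hlaw hind]
  -- Group `i` contributes `K_i` equal factors at the argument `t_i / √K`, and `K_i t_i² / K → p_i
  -- t_i²`. A group with `p_i = 0` contributes the factor `1` in the limit.
  have hlim : ∀ i, Tendsto (fun n => charFun (P.map (deviation D θ₀ T ⟨i, 0⟩))
      (t i * (Real.sqrt (total (K n)))⁻¹) ^ K n i) atTop
      (𝓝 (Complex.exp (-((failProb D θ₀ i * survProb D θ₀ i) * (p i * t i ^ 2) : ℝ) / 2))) := by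
    intro i
    refine tendsto_charFun_pow (aemeasurable_deviation D θ₀ T hT _)
      (mul_pos (failProb_pos D θ₀ i) (survProb_pos D θ₀ i))
      (integral_deviation D θ₀ hlaw _) (integral_deviation_sq D θ₀ hlaw _) ?_ ?_
    · have := (Real.tendsto_sqrt_atTop.comp hN).inv_tendsto_atTop.const_mul (t i)
      simpa using this
    · refine ((hp i).mul_const (t i ^ 2)).congr fun n => ?_
      rw [mul_pow, inv_pow, Real.sq_sqrt (Nat.cast_nonneg _), prop]
      ring
  have hprod := tendsto_finsetProd Finset.univ fun i _ => hlim i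
  rw [← Complex.exp_sum] at hprod
  convert hprod using 3
  rw [inner_zero_right, ← Finset.sum_div]
  simp only [countsCov, Matrix.mulVec_diagonal, dotProduct]
  push_cast
  rw [zero_mul, zero_sub, Finset.sum_neg_distrib, neg_div]
  congr 2
  refine Finset.sum_congr rfl fun i _ => ?_
  ring

end CentralLimit

/-! ### Events of probability tending to one -/

section HighProbability

variable {Ω : Type*} [MeasurableSpace Ω] {P : Measure Ω} {A B : ℕ → Ω → Prop}

/-- The events `A n` have (outer) probability tending to one. -/
def WithHighProb (P : Measure Ω) (A : ℕ → Ω → Prop) : Prop :=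
  Tendsto (fun n => P {ω | ¬ A n ω}) atTop (𝓝 0)

theorem WithHighProb.mono (hA : WithHighProb P A) (h : ∀ᶠ n in atTop, ∀ ω, A n ω → B n ω) :
    WithHighProb P B := by
  refine tendsto_of_tendsto_of_tendsto_of_le_of_le' tendsto_const_nhds hA
    (Eventually.of_forall fun _ => zero_le) ?_
  filter_upwards [h] with n hn
  exact measure_mono fun ω hω hA => hω (hn ω hA)

theorem WithHighProb.and (hA : WithHighProb P A) (hB : WithHighProb P B) :
    WithHighProb P fun n ω => A n ω ∧ B n ω := by
  have h := Tendsto.add hA hB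
  rw [add_zero] at h
  refine tendsto_of_tendsto_of_tendsto_of_le_of_le tendsto_const_nhds h (fun _ => zero_le)
    fun n => (measure_mono fun ω hω => ?_).trans (measure_union_le _ _)
  exact not_and_or.1 hω

/-- Bounding the outer measure of the exceptional set keeps monotonicity and conjunction free of
measurability conditions; these are needed only here, to pass to the complement. -/
theorem withHighProb_iff [IsProbabilityMeasure P]
    (hA : ∀ n, NullMeasurableSet {ω | A n ω} P) :
    WithHighProb P A ↔ Tendsto (fun n => P {ω | A n ω}) atTop (𝓝 1) := by
  have h1 : ∀ n, P {ω | ¬ A n ω} = 1 - P {ω | A n ω} := fun n =>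
    prob_compl_eq_one_sub₀ (hA n)
  have h2 : ∀ n, P {ω | A n ω} = 1 - P {ω | ¬ A n ω} := fun n => by
    rw [h1, ENNReal.sub_sub_cancel ENNReal.one_ne_top prob_le_one]
  constructor
  · intro h
    simp_rw [h2]
    simpa using ENNReal.Tendsto.sub (tendsto_const_nhds (x := (1 : ENNReal))) h
      (Or.inl ENNReal.one_ne_top)
  · intro h
    unfold WithHighProb
    simp_rw [h1]
    simpa using ENNReal.Tendsto.sub (tendsto_const_nhds (x := (1 : ENNReal))) h
      (Or.inl ENNReal.one_ne_top)

theorem tendstoInMeasure_const_iff {E : Type*} [PseudoMetricSpace E] {X : ℕ → Ω → E} {c : E} :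
    TendstoInMeasure P X atTop (fun _ => c) ↔
      ∀ ε > 0, WithHighProb P fun n ω => dist (X n ω) c < ε := by
  simp_rw [tendstoInMeasure_iff_dist, WithHighProb, not_lt]

end HighProbability

/-! ### Uniform bounds on the log-likelihood ratio away from the true parameter -/

section Localization

/-- The inequality `log x ≤ 2 (√x - 1)` replaces the log-likelihood ratio by a Hellinger affinity.
At `c = k a₀` this leaves minus `k` times a squared Hellinger distance, whereas `log x ≤ x - 1`
would leave zero. The coefficient of `c - k a₀` stays bounded as `a` tends to `0` or `1`, although
the logarithms do not; this gives uniformity over a noncompact parameter space. -/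
theorem binomial_logLik_sub_le {a a₀ c k : ℝ} (ha : 0 < a) (ha1 : a < 1) (ha₀ : 0 < a₀)
    (ha₀1 : a₀ < 1) (hc : 0 ≤ c) (hck : c ≤ k) :
    (c * Real.log a + (k - c) * Real.log (1 - a)) -
      (c * Real.log a₀ + (k - c) * Real.log (1 - a₀)) ≤
      -(k * (a - a₀) ^ 2 / 4) +
        |c - k * a₀| * (2 * (1 / Real.sqrt a₀ + 1 / Real.sqrt (1 - a₀))) := by
  have hlog : ∀ {x y : ℝ}, 0 < x → 0 < y →
      Real.log x - Real.log y ≤ 2 * (Real.sqrt x / Real.sqrt y - 1) := by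
    intro x y hx hy
    have h := Real.log_le_sub_one_of_pos (div_pos (Real.sqrt_pos.2 hx) (Real.sqrt_pos.2 hy))
    rw [Real.log_div (Real.sqrt_pos.2 hx).ne' (Real.sqrt_pos.2 hy).ne', Real.log_sqrt hx.le,
      Real.log_sqrt hy.le] at h
    linarith
  have h1 := mul_le_mul_of_nonneg_left (hlog ha ha₀) hc
  have h2 := mul_le_mul_of_nonneg_left (hlog (sub_pos.2 ha1) (sub_pos.2 ha₀1)) (sub_nonneg.2 hck)
  have es : Real.sqrt a ^ 2 = a := Real.sq_sqrt ha.le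
  have et : Real.sqrt (1 - a) ^ 2 = 1 - a := Real.sq_sqrt (sub_pos.2 ha1).le
  have es0 : Real.sqrt a₀ ^ 2 = a₀ := Real.sq_sqrt ha₀.le
  have et0 : Real.sqrt (1 - a₀) ^ 2 = 1 - a₀ := Real.sq_sqrt (sub_pos.2 ha₀1).le
  have ps : 0 < Real.sqrt a := Real.sqrt_pos.2 ha
  have pt : 0 < Real.sqrt (1 - a) := Real.sqrt_pos.2 (sub_pos.2 ha1)
  have ps0 : 0 < Real.sqrt a₀ := Real.sqrt_pos.2 ha₀
  have pt0 : 0 < Real.sqrt (1 - a₀) := Real.sqrt_pos.2 (sub_pos.2 ha₀1)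
  have ls : Real.sqrt a ≤ 1 := Real.sqrt_le_one.2 ha1.le
  have lt : Real.sqrt (1 - a) ≤ 1 := Real.sqrt_le_one.2 (by linarith)
  have ls0 : Real.sqrt a₀ ≤ 1 := Real.sqrt_le_one.2 ha₀1.le
  set s := Real.sqrt a
  set t := Real.sqrt (1 - a)
  set s₀ := Real.sqrt a₀
  set t₀ := Real.sqrt (1 - a₀)
  -- Split `c = k a₀ + (c - k a₀)`; the first part completes to squares because `s² + t² = s₀² + t₀²
  -- = 1`.
  have hid : c * (2 * (s / s₀ - 1)) + (k - c) * (2 * (t / t₀ - 1)) =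
      -(k * ((s - s₀) ^ 2 + (t - t₀) ^ 2)) + (c - k * a₀) * (2 * (s / s₀ - t / t₀)) := by
    have e1 : s / s₀ * a₀ = s * s₀ := by rw [← es0]; field_simp
    have e2 : t / t₀ * (1 - a₀) = t * t₀ := by rw [← et0]; field_simp
    linear_combination (2 * k) * e1 + (2 * k) * e2 + k * es + k * et + k * es0 + k * et0
  -- The constant `4` is the bound on `(s + s₀)²` in `a - a₀ = (s - s₀) (s + s₀)`.
  have hq : (a - a₀) ^ 2 / 4 ≤ (s - s₀) ^ 2 + (t - t₀) ^ 2 := by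
    have e : a - a₀ = (s - s₀) * (s + s₀) := by rw [← es, ← es0]; ring
    have h3 : (s + s₀) ^ 2 ≤ 4 := by nlinarith
    rw [e, mul_pow]
    nlinarith [sq_nonneg (s - s₀), sq_nonneg (t - t₀)]
  have hk := mul_le_mul_of_nonneg_left hq (hc.trans hck)
  have hd : (c - k * a₀) * (2 * (s / s₀ - t / t₀)) ≤ |c - k * a₀| * (2 * (1 / s₀ + 1 / t₀)) := by
    refine (le_abs_self _).trans ?_
    rw [abs_mul]
    refine mul_le_mul_of_nonneg_left ?_ (abs_nonneg _)
    have b1 : s / s₀ ≤ 1 / s₀ := by gcongr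
    have b2 : t / t₀ ≤ 1 / t₀ := by gcongr
    have b3 : 0 < s / s₀ := by positivity
    have b4 : 0 < t / t₀ := by positivity
    rw [abs_le]
    constructor <;> linarith
  linarith

variable {ι : Type*} [Fintype ι] {J : ℕ} (D : Design ι J) (θ₀ : Param J)

/-- The failure probabilities under the conditions with `0 < p i` determine `θ₀` stably in `S`. -/
def WellSeparatedOn (p : ι → ℝ) (S : Set (Param J)) : Prop :=
  ∀ ε > 0, ∃ δ > 0, ∀ θ ∈ S,
    (∀ i, 0 < p i → |failProb D θ i - failProb D θ₀ i| < δ) → dist θ θ₀ < ε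

variable {K : ℕ → ι → ℕ} (hK : Tendsto (fun n => total (K n)) atTop atTop) {p : ι → ℝ}
  (hp : ∀ i, Tendsto (fun n => prop (K n) i) atTop (𝓝 (p i)))
include hK hp

/-- Outside the `ε`-ball some condition `j` with `p_j > 0` has its failure probability off by at
least `δ`. Its drift, of order `K δ²`, outweighs all fluctuations once these are at most `η K`. The
estimate is deterministic in the counts; probability enters only through the event on which it
applies. -/
theorem eventually_logLik_lt {S : Set (Param J)} (hS : WellSeparatedOn D θ₀ p S) {ε : ℝ}
    (hε : 0 < ε) : ∃ η > 0, ∀ᶠ n in atTop, ∀ c : ι → ℕ, (∀ i, c i ≤ K n i) →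
      (∀ i, |(c i : ℝ) - K n i * failProb D θ₀ i| ≤ η * total (K n)) →
      ∀ θ ∈ S, ε ≤ dist θ θ₀ → logLik D (K n) c θ < logLik D (K n) c θ₀ := by
  obtain ⟨δ, hδ, hsep⟩ := hS ε hε
  -- A strict common lower bound, so that the proportions `K_i / K` with `p_i > 0` eventually exceed
  -- it too.
  obtain ⟨m, hm, hmp⟩ : ∃ m > 0, ∀ i, 0 < p i → m < p i := by
    have h : ∀ᶠ m in 𝓝[>] (0 : ℝ), ∀ i, 0 < p i → m < p i := by
      refine eventually_all.2 fun i => ?_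
      by_cases hi : 0 < p i
      · filter_upwards [Ioo_mem_nhdsGT hi] with m hm _ using hm.2
      · exact Eventually.of_forall fun m h => absurd h hi
    obtain ⟨m, h1, h2⟩ := (h.and self_mem_nhdsWithin).exists
    exact ⟨m, h2, h1⟩
  set C : ι → ℝ := fun i => 2 * (1 / Real.sqrt (failProb D θ₀ i) +
    1 / Real.sqrt (1 - failProb D θ₀ i)) with hC
  have hC0 : ∀ i, 0 ≤ C i := fun i => by positivity
  have hCs : 0 ≤ ∑ i, C i := Finset.sum_nonneg fun i _ => hC0 i
  -- Chosen so that the fluctuations contribute at most half of the drift `m δ² K / 4`; the `+ 1`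
  -- keeps the denominator positive.
  set η := m * δ ^ 2 / (8 * (∑ i, C i + 1)) with hη
  have hηpos : 0 < η := by positivity
  refine ⟨η, hηpos, ?_⟩
  have hev : ∀ᶠ n in atTop, ∀ i, 0 < p i → m < prop (K n) i := by
    refine eventually_all.2 fun i => ?_
    by_cases hi : 0 < p i
    · filter_upwards [(hp i).eventually_const_lt (hmp i hi)] with n hn _ using hn
    · exact Eventually.of_forall fun m h => absurd h hi
  filter_upwards [hev, hK.eventually_gt_atTop 0] with n hn hN c hc hdev θ hθ hdist
  have hN' : (0 : ℝ) < total (K n) := by exact_mod_cast hN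
  obtain ⟨j, hj, hjδ⟩ : ∃ j, 0 < p j ∧ δ ≤ |failProb D θ j - failProb D θ₀ j| := by
    by_contra! h
    exact absurd (hsep θ hθ h) (not_lt.2 hdist)
  rw [← sub_neg, logLik_eq D hc, logLik_eq D hc, ← Finset.sum_sub_distrib]
  simp_rw [survProb_eq]
  have hterm := fun i => binomial_logLik_sub_le (failProb_pos D θ i) (failProb_lt_one D θ i)
    (failProb_pos D θ₀ i) (failProb_lt_one D θ₀ i) (Nat.cast_nonneg (c i))
    (Nat.cast_le (α := ℝ).2 (hc i))
  refine (Finset.sum_le_sum fun i _ => hterm i).trans_lt ?_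
  rw [Finset.sum_add_distrib, Finset.sum_neg_distrib]
  have hb1 : ∑ i, |(c i : ℝ) - K n i * failProb D θ₀ i| * C i ≤
      η * total (K n) * ∑ i, C i := by
    rw [Finset.mul_sum]
    exact Finset.sum_le_sum fun i _ => mul_le_mul_of_nonneg_right (hdev i) (hC0 i)
  have hb2 : total (K n) * m * δ ^ 2 / 4 ≤
      ∑ i, (K n i : ℝ) * (failProb D θ i - failProb D θ₀ i) ^ 2 / 4 := by
    refine le_trans ?_ (Finset.single_le_sum (f := fun i =>
      (K n i : ℝ) * (failProb D θ i - failProb D θ₀ i) ^ 2 / 4)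
      (fun i _ => by positivity) (Finset.mem_univ j))
    have h1 : total (K n) * m ≤ K n j := by
      have := hn j hj
      rw [prop, lt_div_iff₀ hN'] at this
      linarith
    have h2 : δ ^ 2 ≤ (failProb D θ j - failProb D θ₀ j) ^ 2 := by
      rw [← sq_abs (_ - _)]
      gcongr
    gcongr
  have hb3 : η * total (K n) * ∑ i, C i < total (K n) * m * δ ^ 2 / 4 := by
    have h1 : η * (∑ i, C i + 1) = m * δ ^ 2 / 8 := by
      rw [hη]; field_simp
    have h2 : η * ∑ i, C i < m * δ ^ 2 / 4 := by nlinarith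
    calc _ = total (K n) * (η * ∑ i, C i) := by ring
      _ < total (K n) * (m * δ ^ 2 / 4) := by gcongr
      _ = _ := by ring
  linarith

variable {Ω : Type*} [MeasurableSpace Ω] {P : Measure Ω} [IsProbabilityMeasure P]
  {T : ι → ℕ → Ω → ℝ}
  (hlaw : ∀ i k, HasLaw (T i k) (loglogisticMeasure (scale D θ₀ i) (shape D θ₀ i)) P)
  (hind : iIndepFun (fun q : ι × ℕ => T q.1 q.2) P)
include hlaw hind

theorem withHighProb_logLik_lt {S : Set (Param J)} (hS : WellSeparatedOn D θ₀ p S) {ε : ℝ}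
    (hε : 0 < ε) : WithHighProb P fun n ω => ∀ θ ∈ S, ε ≤ dist θ θ₀ →
      logLik D (K n) (failures D T (K n) ω) θ < logLik D (K n) (failures D T (K n) ω) θ₀ := by
  obtain ⟨η, hη, hev⟩ := eventually_logLik_lt D θ₀ hK hp hS hε
  have h : WithHighProb P fun n ω => ∀ i,
      |(failures D T (K n) ω i : ℝ) - K n i * failProb D θ₀ i| ≤ η * total (K n) := by
    simpa [WithHighProb, not_forall, not_le] using
      tendsto_measure_deviation_gt D θ₀ hlaw hind K hK hη
  refine h.mono ?_
  filter_upwards [hev] with n hn ω hω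
  exact hn _ (fun i => failures_le D T (K n) ω i) hω

end Localization

/-! ### Existence and consistency of global and local maximizers -/

section Consistency

variable {ι : Type*} [Fintype ι] {J : ℕ} (D : Design ι J) (θ₀ : Param J) {p : ι → ℝ}

omit [Fintype ι] in
theorem wellSeparatedOn_univ (h : WellSeparated D p θ₀) :
    WellSeparatedOn D θ₀ p Set.univ := fun ε hε => by
  obtain ⟨δ, hδ, H⟩ := h ε hε
  exact ⟨δ, hδ, fun θ _ => H θ⟩

/-- Conditions with `p_i = 0` have weight zero in the matrix. Hence, if it is nonsingular, no
nonzero vector is orthogonal to all the gradients from conditions with `p_i > 0`. -/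
theorem fisherMat_mulVec_eq_zero {v : Coord J → ℝ} (hv : ∀ i, 0 < p i →
    ∑ r, gradLogit D θ₀ i r * v r = 0) (hp : ∀ i, 0 ≤ p i) :
    Matrix.mulVec (fisherMat D p θ₀) v = 0 := by
  ext r
  simp only [Matrix.mulVec, dotProduct, fisherMat_apply, Finset.sum_mul, Pi.zero_apply]
  rw [Finset.sum_comm]
  refine Finset.sum_eq_zero fun i _ => ?_
  rcases (hp i).eq_or_lt with h | h
  · simp [← h]
  · have e : ∀ s, p i * (failProb D θ₀ i * survProb D θ₀ i) *
        (gradLogit D θ₀ i r * gradLogit D θ₀ i s) * v s =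
        (p i * (failProb D θ₀ i * survProb D θ₀ i) * gradLogit D θ₀ i r) *
          (gradLogit D θ₀ i s * v s) := fun s => by ring
    simp_rw [e]
    rw [← Finset.mul_sum, hv i h, mul_zero]

/-- Where the Fisher information matrix is nonsingular, the parameter is locally identified. -/
theorem exists_wellSeparatedOn_closedBall (hp : ∀ i, 0 ≤ p i)
    (hdet : (fisherMat D p θ₀).det ≠ 0) :
    ∃ r > 0, WellSeparatedOn D θ₀ p (Metric.closedBall θ₀ r) := by
  let f : Param J → ({i // 0 < p i} → ℝ) := fun θ i => failProb D θ i
  let f' : Param J →L[ℝ] ({i // 0 < p i} → ℝ) := ContinuousLinearMap.pi fun i =>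
    (failProb D θ₀ i * survProb D θ₀ i) • fderiv ℝ (fun η => logit D η i) θ₀
  have hf : HasFDerivAt f f' θ₀ := hasFDerivAt_pi.2 fun i => hasFDerivAt_failProb D θ₀ i
  have hker : LinearMap.ker (f' : Param J →ₗ[ℝ] ({i // 0 < p i} → ℝ)) = ⊥ := by
    rw [LinearMap.ker_eq_bot']
    intro v hv
    have h1 : ∀ i, 0 < p i → ∑ r, gradLogit D θ₀ i r * v r = 0 := by
      intro i hi
      have h2 : (failProb D θ₀ i * survProb D θ₀ i) *
          fderiv ℝ (fun η => logit D η i) θ₀ v = 0 := congrFun hv ⟨i, hi⟩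
      rw [fderiv_apply_eq_sum_grad, grad_logit] at h2
      exact (mul_eq_zero.1 h2).resolve_left
        (mul_pos (failProb_pos D θ₀ i) (survProb_pos D θ₀ i)).ne'
    have h3 := Matrix.eq_zero_of_mulVec_eq_zero hdet (fisherMat_mulVec_eq_zero D θ₀ h1 hp)
    ext r
    exact congrFun h3 r
  -- An injective linear map on a finite-dimensional space is bounded below, so near `θ₀` the
  -- distance `‖θ - θ₀‖` is at most a constant times `‖f θ - f θ₀‖`.
  obtain ⟨C, -, hC⟩ := LinearMap.exists_antilipschitzWith _ hker
  obtain ⟨M, hM⟩ := (hf.isTheta_sub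
    (hC.isUniformInducing f'.uniformContinuous).isInducing).2.bound
  obtain ⟨r, hr, hball⟩ := Metric.nhds_basis_closedBall.eventually_iff.1 hM
  refine ⟨r, hr, fun ε hε => ⟨ε / (|M| + 1), by positivity, fun θ hθ hF => ?_⟩⟩
  have h1 := hball hθ
  have h2 : ‖f θ - f θ₀‖ ≤ ε / (|M| + 1) :=
    (pi_norm_le_iff_of_nonneg (by positivity)).2 fun i => (hF i i.2).le
  rw [dist_eq_norm]
  calc ‖θ - θ₀‖ ≤ M * ‖f θ - f θ₀‖ := h1
    _ ≤ |M| * (ε / (|M| + 1)) := by gcongr; exact le_abs_self M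
    _ < (|M| + 1) * (ε / (|M| + 1)) := by gcongr; linarith
    _ = ε := by field_simp

variable {K : ℕ → ι → ℕ} (hK : Tendsto (fun n => total (K n)) atTop atTop)
  (hp : ∀ i, Tendsto (fun n => prop (K n) i) atTop (𝓝 (p i)))
  {Ω : Type*} [MeasurableSpace Ω] {P : Measure Ω} [IsProbabilityMeasure P]
  {T : ι → ℕ → Ω → ℝ}
  (hlaw : ∀ i k, HasLaw (T i k) (loglogisticMeasure (scale D θ₀ i) (shape D θ₀ i)) P)
  (hind : iIndepFun (fun q : ι × ℕ => T q.1 q.2) P)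
  {est : ℕ → (ι → ℕ) → Param J}

include hlaw in
omit [IsProbabilityMeasure P] in
theorem nullMeasurableSet_failures (k : ι → ℕ) (A : (ι → ℕ) → Prop) :
    NullMeasurableSet {ω | A (failures D T k ω)} P :=
  (aemeasurable_failures D T (fun i k => (hlaw i k).aemeasurable) k).nullMeasurableSet_preimage
    (MeasurableSet.of_discrete (s := {c | A c}))

include hK hp hlaw hind

/-- When every parameter at distance at least `1` does worse than `θ₀`, a maximizer over the compact
unit ball is a global one. A maximizer therefore exists, and the MLE must select one; the radius is
arbitrary. -/
theorem withHighProb_isMaximizer (hsep : WellSeparated D p θ₀)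
    (hest : ∀ n, IsMLE D (K n) (est n)) :
    WithHighProb P fun n ω =>
      IsMaximizer D (K n) (failures D T (K n) ω) (est n (failures D T (K n) ω)) := by
  refine (withHighProb_logLik_lt D θ₀ hK hp hlaw hind (wellSeparatedOn_univ D θ₀ hsep)
    one_pos).mono (Eventually.of_forall fun n ω h => ?_)
  refine hest n _ (fun i => failures_le D T (K n) ω i) ?_
  obtain ⟨θ, -, hθ⟩ := (isCompact_closedBall θ₀ 1).exists_isMaxOn
    ⟨θ₀, Metric.mem_closedBall_self zero_le_one⟩
    (continuous_logLik D (K := K n) (c := failures D T (K n) ω)).continuousOn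
  refine ⟨θ, fun θ' => ?_⟩
  rcases le_or_gt (dist θ' θ₀) 1 with h1 | h1
  · exact hθ h1
  · exact (h θ' trivial h1.le).le.trans (hθ (Metric.mem_closedBall_self zero_le_one))

/-- Doing at least as well as `θ₀` within a separated set is all that consistency needs. This serves
the global MLE, with `S` the whole space, and the local maximizers, with `S` a ball. -/
theorem consistent_of_le {S : Set (Param J)} (hsep : WellSeparatedOn D θ₀ p S)
    (hest : WithHighProb P fun n ω => est n (failures D T (K n) ω) ∈ S ∧
      logLik D (K n) (failures D T (K n) ω) θ₀ ≤
        logLik D (K n) (failures D T (K n) ω) (est n (failures D T (K n) ω))) :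
    Consistent P D θ₀ T K est := by
  refine tendstoInMeasure_const_iff.2 fun ε hε => ?_
  refine (hest.and (withHighProb_logLik_lt D θ₀ hK hp hlaw hind hsep hε)).mono
    (Eventually.of_forall fun n ω h => ?_)
  by_contra! hd
  exact absurd (h.2 _ h.1.1 hd) (not_lt.2 h.1.2)

/-- Maximize over a fixed closed ball on which the parameter is identified. Consistency puts the
maximizer in the interior with probability tending to one, and there it is a local maximizer on the
whole space. -/
theorem exists_consistent_isLocalMax (hdet : (fisherMat D p θ₀).det ≠ 0) :
    ∃ est : ℕ → (ι → ℕ) → Param J,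
      Tendsto (fun n => P {ω | IsLocalMax (logLik D (K n) (failures D T (K n) ω))
        (est n (failures D T (K n) ω))}) atTop (𝓝 1) ∧ Consistent P D θ₀ T K est := by
  have hp0 : ∀ i, 0 ≤ p i := fun i =>
    ge_of_tendsto' (hp i) fun n => div_nonneg (Nat.cast_nonneg _) (Nat.cast_nonneg _)
  obtain ⟨r, hr, hsep⟩ := exists_wellSeparatedOn_closedBall D θ₀ hp0 hdet
  have hθ₀ : θ₀ ∈ Metric.closedBall θ₀ r := Metric.mem_closedBall_self hr.le
  have hex : ∀ (n : ℕ) (c : ι → ℕ), ∃ θ ∈ Metric.closedBall θ₀ r,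
      IsMaxOn (logLik D (K n) c) (Metric.closedBall θ₀ r) θ := fun n c =>
    (isCompact_closedBall θ₀ r).exists_isMaxOn ⟨θ₀, hθ₀⟩ (continuous_logLik D).continuousOn
  choose est hmem hmax using hex
  have hcons : Consistent P D θ₀ T K est :=
    consistent_of_le D θ₀ hK hp hlaw hind hsep <| by
      have : ∀ n ω, est n (failures D T (K n) ω) ∈ Metric.closedBall θ₀ r ∧
          logLik D (K n) (failures D T (K n) ω) θ₀ ≤
            logLik D (K n) (failures D T (K n) ω) (est n (failures D T (K n) ω)) :=
        fun n ω => ⟨hmem n _, hmax n _ hθ₀⟩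
      simp [WithHighProb, this]
  refine ⟨est, ?_, hcons⟩
  refine (withHighProb_iff fun n => nullMeasurableSet_failures D θ₀ hlaw (K n) fun c =>
    IsLocalMax (logLik D (K n) c) (est n c)).1 ?_
  refine (tendstoInMeasure_const_iff.1 hcons r hr).mono (Eventually.of_forall fun n ω h => ?_)
  exact (hmax n _).isLocalMax (Metric.closedBall_mem_nhds_of_mem h)

end Consistency

/-! ### Linear images of Gaussian laws -/

section Gaussian

/-- A linear image of a centred Gaussian law. -/
theorem map_multivariateGaussian_mulVec {m n : Type*} [Fintype m] [DecidableEq m] [Fintype n]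
    [DecidableEq n] {S : Matrix n n ℝ} (hS : S.PosSemidef) (B : Matrix m n ℝ) :
    (multivariateGaussian (0 : EuclideanSpace ℝ n) S).map
      (fun z => WithLp.toLp 2 (B.mulVec z.ofLp) : EuclideanSpace ℝ n → EuclideanSpace ℝ m) =
      multivariateGaussian 0 (B * S * B.transpose) := by
  have hcont : Continuous
      (fun z => WithLp.toLp 2 (B.mulVec z.ofLp) : EuclideanSpace ℝ n → EuclideanSpace ℝ m) := by
    unfold Matrix.mulVec dotProduct
    fun_prop
  have hBS : (B * S * B.transpose).PosSemidef := by
    have := hS.mul_mul_conjTranspose_same B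
    rwa [Matrix.conjTranspose_eq_transpose_of_trivial] at this
  have hprob := Measure.isProbabilityMeasure_map
    (μ := multivariateGaussian (0 : EuclideanSpace ℝ n) S) hcont.aemeasurable
  refine Measure.ext_of_charFun (funext fun t => ?_)
  have h1 : ∀ z : EuclideanSpace ℝ n,
      inner ℝ (WithLp.toLp 2 (B.mulVec z.ofLp) : EuclideanSpace ℝ m) t =
        inner ℝ z (WithLp.toLp 2 (B.transpose.mulVec t.ofLp) : EuclideanSpace ℝ n) := by
    intro z
    rw [EuclideanSpace.inner_eq_star_dotProduct, EuclideanSpace.inner_eq_star_dotProduct]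
    simp only [star_trivial]
    rw [Matrix.mulVec_transpose, ← Matrix.dotProduct_mulVec]
  have h2 : charFun ((multivariateGaussian (0 : EuclideanSpace ℝ n) S).map
      (fun z => WithLp.toLp 2 (B.mulVec z.ofLp) : EuclideanSpace ℝ n → EuclideanSpace ℝ m)) t =
      charFun (multivariateGaussian (0 : EuclideanSpace ℝ n) S)
        (WithLp.toLp 2 (B.transpose.mulVec t.ofLp)) := by
    rw [charFun_apply, charFun_apply, integral_map hcont.aemeasurable (by fun_prop)]
    simp_rw [h1]
  rw [h2, charFun_multivariateGaussian hS, charFun_multivariateGaussian hBS, inner_zero_right,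
    inner_zero_right]
  congr 4
  rw [Matrix.mulVec_transpose, ← Matrix.dotProduct_mulVec, ← Matrix.mulVec_transpose,
    Matrix.mulVec_mulVec, Matrix.mulVec_mulVec, Matrix.mul_assoc]

end Gaussian

/-! ### Asymptotic normality of consistent roots -/

section Normality

/-- A differentiable function factors through a matrix of slopes that is continuous at the
base point. -/
theorem exists_slope {J : ℕ} {f : Param J → ℝ} {f' : Param J →L[ℝ] ℝ} {θ₀ : Param J}
    (hf : HasFDerivAt f f' θ₀) : ∃ h : Param J → Coord J → ℝ,
      (∀ r, ContinuousAt (fun θ => h θ r) θ₀) ∧ (∀ r, h θ₀ r = f' (EuclideanSpace.single r 1)) ∧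
      ∀ θ, f θ - f θ₀ = ∑ r, h θ r * (θ r - θ₀ r) := by
  set R : Param J → ℝ := fun θ => f θ - f θ₀ - f' (θ - θ₀) with hR
  -- The remainder `R` is spread along the direction `θ - θ₀`: pairing with `θ - θ₀` restores it
  -- exactly, and the correction is at most `|R| / ‖θ - θ₀‖`, which tends to `0`. At `θ₀` the
  -- correction vanishes.
  refine ⟨fun θ r => f' (EuclideanSpace.single r 1) + R θ / ‖θ - θ₀‖ ^ 2 * (θ r - θ₀ r),
    fun r => ?_, fun r => by simp, fun θ => ?_⟩
  · refine continuousAt_const.add ?_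
    rw [ContinuousAt, sub_self (θ₀ r), mul_zero]
    have ho : Tendsto (fun θ => ‖R θ‖ / ‖θ - θ₀‖) (𝓝 θ₀) (𝓝 0) :=
      hf.isLittleO.norm_norm.tendsto_div_nhds_zero
    refine squeeze_zero_norm (fun θ => ?_) ho
    rw [norm_mul, norm_div, norm_pow, norm_norm]
    have h1 : ‖θ r - θ₀ r‖ ≤ ‖θ - θ₀‖ := PiLp.norm_apply_le (θ - θ₀) r
    rcases (norm_nonneg (θ - θ₀)).eq_or_lt with h | h
    · simp [← h]
    · rw [div_mul_eq_mul_div, div_le_div_iff₀ (by positivity) h]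
      calc ‖R θ‖ * ‖θ r - θ₀ r‖ * ‖θ - θ₀‖ ≤ ‖R θ‖ * ‖θ - θ₀‖ * ‖θ - θ₀‖ := by gcongr
        _ = _ := by ring
  · have h1 : f' (θ - θ₀) = ∑ r, f' (EuclideanSpace.single r 1) * (θ r - θ₀ r) := by
      conv_lhs => rw [param_eq_sum_single (θ - θ₀), map_sum]
      refine Finset.sum_congr rfl fun r _ => ?_
      rw [map_smul, smul_eq_mul, mul_comm]
      rfl
    have h2 : ‖θ - θ₀‖ ^ 2 = ∑ r, (θ r - θ₀ r) * (θ r - θ₀ r) := by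
      rw [EuclideanSpace.real_norm_sq_eq]
      exact Finset.sum_congr rfl fun r _ => pow_two _
    simp_rw [add_mul, Finset.sum_add_distrib, ← h1, mul_assoc, ← Finset.mul_sum, ← h2]
    rcases eq_or_ne θ θ₀ with h | h
    · simp [h]
    · have : ‖θ - θ₀‖ ≠ 0 := norm_ne_zero_iff.2 (sub_ne_zero.2 h)
      rw [div_mul_cancel₀ _ (pow_ne_zero 2 this), hR]
      ring

variable {ι : Type*} [Fintype ι] {J : ℕ} (D : Design ι J) (θ₀ : Param J)

/-- The matrix whose columns are the gradients of the log-odds. -/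
noncomputable def gradMat (θ : Param J) : Matrix (Coord J) ι ℝ :=
  Matrix.of fun r i => gradLogit D θ i r

/-- The Fisher information matrix with one gradient replaced by slopes. -/
noncomputable def slopeMat (h : ι → Param J → Coord J → ℝ) (x : (ι → ℝ) × Param J) :
    Matrix (Coord J) (Coord J) ℝ :=
  Matrix.of fun r s => ∑ i, x.1 i * (gradLogit D x.2 i r * h i x.2 s)

theorem fisherMat_eq_mul [DecidableEq ι] (p : ι → ℝ) :
    fisherMat D p θ₀ = gradMat D θ₀ * countsCov D θ₀ p * (gradMat D θ₀).transpose := by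
  ext r s
  rw [fisherMat_apply, Matrix.mul_apply]
  simp only [countsCov, Matrix.mul_diagonal, Matrix.transpose_apply, gradMat, Matrix.of_apply]
  exact Finset.sum_congr rfl fun i _ => by ring

/-- The limiting covariance of the score, divided by `√K`, is again the information matrix, so one
of the two inverses in the sandwich cancels. -/
theorem inv_mul_countsCov_mul [DecidableEq ι] {p : ι → ℝ} (hp : ∀ i, 0 ≤ p i)
    (hdet : (fisherMat D p θ₀).det ≠ 0) :
    ((fisherMat D p θ₀)⁻¹ * gradMat D θ₀) * countsCov D θ₀ p *
      ((fisherMat D p θ₀)⁻¹ * gradMat D θ₀).transpose = (fisherMat D p θ₀)⁻¹ := by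
  have hsymm : (fisherMat D p θ₀).transpose = fisherMat D p θ₀ := by
    have := (fisherMat_posSemidef D hp θ₀).isHermitian.eq
    rwa [Matrix.conjTranspose_eq_transpose_of_trivial] at this
  have hu : IsUnit (fisherMat D p θ₀).det := isUnit_iff_ne_zero.2 hdet
  rw [Matrix.transpose_mul, Matrix.transpose_nonsing_inv, hsymm]
  calc _ = (fisherMat D p θ₀)⁻¹ *
        (gradMat D θ₀ * countsCov D θ₀ p * (gradMat D θ₀).transpose) * (fisherMat D p θ₀)⁻¹ := by
        simp only [Matrix.mul_assoc]
    _ = _ := by rw [← fisherMat_eq_mul, Matrix.nonsing_inv_mul _ hu, Matrix.one_mul]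

/-- The error of a root of the likelihood equations, in terms of the normalized counts. -/
theorem sqrt_smul_sub_eq_of_grad_eq_zero {h : ι → Param J → Coord J → ℝ}
    (hh : ∀ i θ, failProb D θ i - failProb D θ₀ i = ∑ r, h i θ r * (θ r - θ₀ r))
    {K c : ι → ℕ} (hc : ∀ i, c i ≤ K i) (hN : 0 < total K) {θ : Param J}
    (hθ : grad (logLik D K c) θ = 0) (hdet : (slopeMat D h (prop K, θ)).det ≠ 0) :
    Real.sqrt (total K) • (θ - θ₀) = WithLp.toLp 2
      (((slopeMat D h (prop K, θ))⁻¹ * gradMat D θ).mulVec (normalizedCounts D θ₀ K c).ofLp) := by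
  have hN' : (0 : ℝ) < total K := by exact_mod_cast hN
  have hs : 0 < Real.sqrt (total K) := Real.sqrt_pos.2 hN'
  set A := slopeMat D h (prop K, θ) with hA
  have hu : IsUnit A.det := isUnit_iff_ne_zero.2 hdet
  -- The score equation reads `∑ (c_i - K_i F_i(θ₀)) g_i = ∑ K_i (F_i(θ) - F_i(θ₀)) g_i`, with `g_i`
  -- taken at the root `θ` itself. The slopes make the right side linear in `θ - θ₀` without
  -- remainder.
  have key : A.mulVec (Real.sqrt (total K) • (θ - θ₀)).ofLp =
      (gradMat D θ).mulVec (normalizedCounts D θ₀ K c).ofLp := by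
    ext r
    have h0 := congrFun hθ r
    rw [grad_logLik D hc, Pi.zero_apply] at h0
    have h1 : ∑ i, ((c i : ℝ) - K i * failProb D θ₀ i) * gradLogit D θ i r =
        ∑ i, ∑ s, (K i : ℝ) * (gradLogit D θ i r * h i θ s) * (θ s - θ₀ s) := by
      rw [← sub_eq_zero, ← Finset.sum_sub_distrib]
      refine Eq.trans (Finset.sum_congr rfl fun i _ => ?_) h0
      have : ∑ s, (K i : ℝ) * (gradLogit D θ i r * h i θ s) * (θ s - θ₀ s) =
          K i * gradLogit D θ i r * (failProb D θ i - failProb D θ₀ i) := by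
        rw [hh, Finset.mul_sum]
        exact Finset.sum_congr rfl fun s _ => by ring
      rw [this]
      ring
    have h2 : (gradMat D θ).mulVec (normalizedCounts D θ₀ K c).ofLp r =
        (Real.sqrt (total K))⁻¹ *
          ∑ i, ((c i : ℝ) - K i * failProb D θ₀ i) * gradLogit D θ i r := by
      simp only [Matrix.mulVec, dotProduct, gradMat, normalizedCounts, Matrix.of_apply]
      rw [Finset.mul_sum]
      exact Finset.sum_congr rfl fun i _ => by ring
    rw [h2, h1, Finset.sum_comm, Finset.mul_sum]
    simp only [Matrix.mulVec, dotProduct, hA, slopeMat, Matrix.of_apply]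
    refine Finset.sum_congr rfl fun s _ => ?_
    rw [Finset.sum_mul, Finset.mul_sum]
    refine Finset.sum_congr rfl fun i _ => ?_
    have e : (K i : ℝ) = Real.sqrt (total K) * Real.sqrt (total K) * prop K i := by
      rw [Real.mul_self_sqrt hN'.le, prop]; field_simp
    rw [e]
    simp only [PiLp.smul_apply, PiLp.sub_apply, smul_eq_mul]
    field_simp
  rw [← Matrix.mulVec_mulVec, ← key, Matrix.mulVec_mulVec, Matrix.nonsing_inv_mul _ hu,
    Matrix.one_mulVec]

variable {K : ℕ → ι → ℕ} (hK : Tendsto (fun n => total (K n)) atTop atTop) {p : ι → ℝ}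
  (hp : ∀ i, Tendsto (fun n => prop (K n) i) atTop (𝓝 (p i)))
  {Ω : Type*} [MeasurableSpace Ω] {P : Measure Ω} [IsProbabilityMeasure P]
  {T : ι → ℕ → Ω → ℝ}
  (hlaw : ∀ i k, HasLaw (T i k) (loglogisticMeasure (scale D θ₀ i) (shape D θ₀ i)) P)
  (hind : iIndepFun (fun q : ι × ℕ => T q.1 q.2) P)
  {est : ℕ → (ι → ℕ) → Param J}
include hp

omit [IsProbabilityMeasure P] in
theorem Consistent.withHighProb_mem (hcons : Consistent P D θ₀ T K est)
    {s : Set ((ι → ℝ) × Param J)} (hs : s ∈ 𝓝 (p, θ₀)) :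
    WithHighProb P fun n ω => (prop (K n), est n (failures D T (K n) ω)) ∈ s := by
  obtain ⟨U, hU, V, hV, hUV⟩ := mem_nhds_prod_iff.1 hs
  obtain ⟨ε, hε, hball⟩ := Metric.mem_nhds_iff.1 hV
  have hprop : Tendsto (fun n => prop (K n)) atTop (𝓝 p) := tendsto_pi_nhds.2 hp
  refine (tendstoInMeasure_const_iff.1 hcons ε hε).mono ?_
  filter_upwards [hprop hU] with n hn ω hω
  exact hUV ⟨hn, hball hω⟩

include hK hlaw hind

/-- Consistent roots of the likelihood equations are asymptotically normal. -/
theorem asympNormal_of_grad_eq_zero (hdet : (fisherMat D p θ₀).det ≠ 0)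
    (hroot : WithHighProb P fun n ω => grad (logLik D (K n) (failures D T (K n) ω))
      (est n (failures D T (K n) ω)) = 0)
    (hcons : Consistent P D θ₀ T K est) : AsympNormal P D p θ₀ T K est := by
  classical
  have hT : ∀ i k, AEMeasurable (T i k) P := fun i k => (hlaw i k).aemeasurable
  have hp0 : ∀ i, 0 ≤ p i := fun i =>
    ge_of_tendsto' (hp i) fun n => div_nonneg (Nat.cast_nonneg _) (Nat.cast_nonneg _)
  choose h hcont hval hh using fun i => exists_slope (hasFDerivAt_failProb D θ₀ i)
  have hA0 : slopeMat D h (p, θ₀) = fisherMat D p θ₀ := by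
    ext r s
    simp only [slopeMat, Matrix.of_apply, fisherMat_apply, hval]
    refine Finset.sum_congr rfl fun i _ => ?_
    have : fderiv ℝ (fun η => logit D η i) θ₀ (EuclideanSpace.single s 1) =
        gradLogit D θ₀ i s := congrFun (grad_logit D θ₀ i) s
    rw [smul_apply, this, smul_eq_mul]
    ring
  have hAc : ContinuousAt (slopeMat D h) (p, θ₀) := by
    refine continuousAt_pi.2 fun r => continuousAt_pi.2 fun s => ?_
    refine tendsto_finsetSum _ fun i _ => ?_
    have c1 : ContinuousAt (fun x : (ι → ℝ) × Param J => x.1 i) (p, θ₀) := by fun_prop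
    have c2 : ContinuousAt (fun x : (ι → ℝ) × Param J => gradLogit D x.2 i r) (p, θ₀) :=
      ((continuous_gradLogit D i r).comp continuous_snd).continuousAt
    have c3 : ContinuousAt (fun x : (ι → ℝ) × Param J => h i x.2 s) (p, θ₀) :=
      (hcont i s).comp (f := Prod.snd) (x := (p, θ₀)) continuousAt_snd
    exact c1.mul (c2.mul c3)
  -- The codomain is a function space rather than a matrix type, so that its sup metric can be used
  -- for convergence in measure.
  let B : (ι → ℝ) × Param J → Coord J → ι → ℝ := fun x =>
    (slopeMat D h x)⁻¹ * gradMat D x.2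
  have hdetA : (slopeMat D h (p, θ₀)).det ≠ 0 := by rwa [hA0]
  have hBc : ContinuousAt B (p, θ₀) := by
    have c1 : ContinuousAt (fun x => (slopeMat D h x)⁻¹) (p, θ₀) := by
      refine ContinuousAt.comp (g := Inv.inv) (continuousAt_matrix_inv _ ?_) hAc
      rw [Ring.inverse_eq_inv']
      exact continuousAt_inv₀ hdetA
    have c2 : ContinuousAt (fun x : (ι → ℝ) × Param J => gradMat D x.2) (p, θ₀) :=
      continuousAt_pi.2 fun r => continuousAt_pi.2 fun i =>
        ((continuous_gradLogit D i r).comp continuous_snd).continuousAt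
    have hmul : Continuous fun M : Matrix (Coord J) (Coord J) ℝ × Matrix (Coord J) ι ℝ =>
        M.1 * M.2 := continuous_fst.matrix_mul continuous_snd
    exact hmul.continuousAt.comp (c1.prodMk c2)
  let Y : ℕ → Ω → Coord J → ι → ℝ := fun n ω => B (prop (K n), est n (failures D T (K n) ω))
  have hY : TendstoInMeasure P Y atTop fun _ => B (p, θ₀) :=
    tendstoInMeasure_const_iff.2 fun ε hε =>
      hcons.withHighProb_mem D θ₀ hp (hBc (Metric.ball_mem_nhds _ hε))
  let g : EuclideanSpace ℝ ι × (Coord J → ι → ℝ) → Param J := fun z =>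
    WithLp.toLp 2 ((Matrix.of z.2).mulVec z.1.ofLp)
  have hg : Continuous g := by
    unfold g Matrix.mulVec dotProduct
    fun_prop
  -- Slutsky: the counts converge in distribution and the random matrix `Y` converges in probability
  -- to a constant.
  have hclt := (tendstoInDistribution_normalizedCounts D θ₀ hlaw hind K hK p hp
    ).continuous_comp_prodMk_of_tendstoInMeasure_const hg hY fun n =>
      aemeasurable_comp_failures D hT (K n) fun c => B (prop (K n), est n c)
  have hroot' : WithHighProb P fun n ω =>
      Real.sqrt (total (K n)) • (est n (failures D T (K n) ω) - θ₀) =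
        g (normalizedCounts D θ₀ (K n) (failures D T (K n) ω), Y n ω) := by
    have hd : ∀ᶠ x in 𝓝 (p, θ₀), (slopeMat D h x).det ≠ 0 :=
      ((Continuous.matrix_det continuous_id).continuousAt.comp hAc).eventually_ne hdetA
    refine (hroot.and (hcons.withHighProb_mem D θ₀ hp hd)).mono ?_
    filter_upwards [hK.eventually_gt_atTop 0] with n hn ω hω
    exact sqrt_smul_sub_eq_of_grad_eq_zero D θ₀ hh (fun i => failures_le D T (K n) ω i) hn
      hω.1 hω.2
  -- The linear representation holds only where the estimator is a root and the slope matrix is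
  -- invertible. Off that event the difference is arbitrary, but it still tends to zero in
  -- probability.
  have hlim := tendstoInDistribution_of_tendstoInMeasure_sub
    (fun n ω => Real.sqrt (total (K n)) • (est n (failures D T (K n) ω) - θ₀)) _ hclt
    (tendstoInMeasure_const_iff.2 fun ε hε => hroot'.mono (Eventually.of_forall fun n ω hω => by
      rw [Pi.sub_apply, Pi.sub_apply, hω, sub_self]
      simpa using hε))
    fun n => aemeasurable_comp_failures D hT (K n) fun c =>
      Real.sqrt (total (K n)) • (est n c - θ₀)
  have hmap : (multivariateGaussian 0 (countsCov D θ₀ p)).map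
      (fun z => g (id z, B (p, θ₀))) = (multivariateGaussian (0 : Param J)
        (fisherMat D p θ₀)⁻¹).map id := by
    rw [Measure.map_id, ← inv_mul_countsCov_mul D θ₀ hp0 hdet,
      ← map_multivariateGaussian_mulVec (countsCov_posSemidef D θ₀ hp0), ← hA0]
    rfl
  refine ⟨hlim.forall_aemeasurable, aemeasurable_id, ?_⟩
  have hlim' := hlim.tendsto
  convert hlim' using 2
  exact congrArg 𝓝 (Subtype.ext hmap.symm)

/-- Maximum likelihood estimators solve the likelihood equations. -/
theorem asympNormal_of_isMLE (hdet : (fisherMat D p θ₀).det ≠ 0) (hsep : WellSeparated D p θ₀)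
    (hest : ∀ n, IsMLE D (K n) (est n)) :
    Tendsto (fun n => P {ω | IsMaximizer D (K n) (failures D T (K n) ω)
        (est n (failures D T (K n) ω))}) atTop (𝓝 1) ∧
      Consistent P D θ₀ T K est ∧ AsympNormal P D p θ₀ T K est := by
  have hmax := withHighProb_isMaximizer D θ₀ hK hp hlaw hind hsep hest
  have hcons : Consistent P D θ₀ T K est :=
    consistent_of_le D θ₀ hK hp hlaw hind (wellSeparatedOn_univ D θ₀ hsep)
      (hmax.mono (Eventually.of_forall fun n ω h => ⟨trivial, h θ₀⟩))
  refine ⟨(withHighProb_iff fun n => nullMeasurableSet_failures D θ₀ hlaw (K n) fun c =>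
    IsMaximizer D (K n) c (est n c)).1 hmax, hcons, ?_⟩
  refine asympNormal_of_grad_eq_zero D θ₀ hK hp hlaw hind hdet
    (hmax.mono (Eventually.of_forall fun n ω h => ?_)) hcons
  have hloc : IsLocalMax (logLik D (K n) (failures D T (K n) ω))
      (est n (failures D T (K n) ω)) := Eventually.of_forall h
  ext r
  rw [grad, hloc.fderiv_eq_zero]
  rfl

end Normality

end OneShot

theorem mainTheorem8 {ι : Type*} [Fintype ι] {J : ℕ} (D : OneShot.Design ι J)
    (θ₀ : OneShot.Param J)
    {Ω : Type*} [MeasurableSpace Ω] (P : Measure Ω) [IsProbabilityMeasure P]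
    -- independent log-logistic lifetimes with the true parameter `θ₀`
    (T : ι → ℕ → Ω → ℝ)
    (hlaw : ∀ i k, HasLaw (T i k)
      (OneShot.loglogisticMeasure (OneShot.scale D θ₀ i) (OneShot.shape D θ₀ i)) P)
    (hind : iIndepFun (fun q : ι × ℕ => T q.1 q.2) P)
    -- sample sizes `K n i` with `∑ i, K n i → ∞` and `K n i / ∑ i, K n i → p i`
    (K : ℕ → ι → ℕ) (hK : Tendsto (fun n => OneShot.total (K n)) atTop atTop)
    (p : ι → ℝ) (hp : ∀ i, Tendsto (fun n => OneShot.prop (K n) i) atTop (𝓝 (p i))) :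
    -- `J_0 = K_0 = I_F`, for all proportions and all parameters
    (∀ (w : ι → ℝ) (θ : OneShot.Param J),
      OneShot.matJ D w 0 θ = OneShot.fisherMat D w θ ∧
      OneShot.matK D w 0 θ = OneShot.fisherMat D w θ) ∧
    -- `I_F` is the Fisher information matrix, per device
    (∀ n r s, ∫ ω, OneShot.grad (OneShot.logLik D (K n) (OneShot.failures D T (K n) ω)) θ₀ r *
          OneShot.grad (OneShot.logLik D (K n) (OneShot.failures D T (K n) ω)) θ₀ s ∂P =
        (OneShot.total (K n) : ℝ) * OneShot.fisherMat D (OneShot.prop (K n)) θ₀ r s) ∧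
    -- asymptotic distribution, when `I_F(θ₀)` is nonsingular
    ((OneShot.fisherMat D p θ₀).det ≠ 0 →
      -- the MLE, when the model is identified at `θ₀`
      (OneShot.WellSeparated D p θ₀ →
        ∀ est : ℕ → (ι → ℕ) → OneShot.Param J, (∀ n, OneShot.IsMLE D (K n) (est n)) →
          Tendsto (fun n => P {ω | OneShot.IsMaximizer D (K n) (OneShot.failures D T (K n) ω)
            (est n (OneShot.failures D T (K n) ω))}) atTop (𝓝 1) ∧
          OneShot.Consistent P D θ₀ T K est ∧
          OneShot.AsympNormal P D p θ₀ T K est) ∧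
      -- the likelihood equations, without that condition: there are consistent roots
      (∃ est : ℕ → (ι → ℕ) → OneShot.Param J,
        Tendsto (fun n => P {ω | IsLocalMax
            (OneShot.logLik D (K n) (OneShot.failures D T (K n) ω))
            (est n (OneShot.failures D T (K n) ω))}) atTop (𝓝 1) ∧
        OneShot.Consistent P D θ₀ T K est) ∧
      -- and all consistent roots are asymptotically normal
      (∀ est : ℕ → (ι → ℕ) → OneShot.Param J,
        Tendsto (fun n => P {ω | OneShot.grad
            (OneShot.logLik D (K n) (OneShot.failures D T (K n) ω))
            (est n (OneShot.failures D T (K n) ω)) = 0}) atTop (𝓝 1) →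
        OneShot.Consistent P D θ₀ T K est →
        OneShot.AsympNormal P D p θ₀ T K est)) := by
  refine ⟨fun w θ => ⟨OneShot.matJ_zero D w θ, OneShot.matK_zero D w θ⟩,
    fun n r s => OneShot.integral_score_mul_score D θ₀ hlaw hind (K n) r s,
    fun hdet => ⟨fun hsep est hest => OneShot.asympNormal_of_isMLE D θ₀ hK hp hlaw hind hdet hsep
      hest, OneShot.exists_consistent_isLocalMax D θ₀ hK hp hlaw hind hdet,
      fun est hroot hcons => ?_⟩⟩
  refine OneShot.asympNormal_of_grad_eq_zero D θ₀ hK hp hlaw hind hdet ?_ hcons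
  exact (OneShot.withHighProb_iff fun n => OneShot.nullMeasurableSet_failures D θ₀ hlaw (K n)
    fun c => OneShot.grad (OneShot.logLik D (K n) c) (est n c) = 0).2 hroot
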